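/- Let $K$ be an algebraically closed field of characteristic $2$. Let $X=\{F=0\}\subset\mathbb{P}^3_K$ be a normal quartic surface, i.e. the set $\mathrm{Sing}(X)$ of points where $F$ and all its partial derivatives vanish is finite. Let $P$ be a double point of $X$, choose coordinates $(x_1,x_2,x_3,z)$ with $P=\{x_1=x_2=x_3=0,\ z=1\}$, and write $$F = z^2Q(x)+zG(x)+B(x)$$ with $Q\neq 0$, $G$, $B$ homogeneous in $x=(x_1,x_2,x_3)$ of degrees $2,3,4$; thus $\{Q=0\}$ is the tangent cone of $X$ at $P$. Assume that the projection $(x,z)\mapsto x$ of $X$ from $P$ is an inseparable double cover of $\mathbb{P}^2$, i.e. $G\equiv 0$. Then: (i) $|\mathrm{Sing}(X)|\le 16$; (ii) if $\{Q=0\}$ is a double plane ($Q=\ell^2$ for a nonzero linear form $\ell$), then $|\mathrm{Sing}(X)|\le 10$; (iii) if $\{Q=0\}$ consists of two distinct planes ($Q=\ell m$ for linearly independent linear forms $\ell,m$), then $|\mathrm{Sing}(X)|\le 13$. Moreover, there is such a quartic with exactly $14$ singular points. Explicitly, for $a_1,a_2,a_3\in K$ put $y_3=a_1x_1+a_2x_2+a_3x_3$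 and $$X_a=\{\,z^2(x_1x_2+x_3^2)+(y_3+x_1)(y_3+x_2)\,y_3\,(y_3+x_1+x_2)=0\,\}.$$ There exist $a_1,a_2,a_3\in K$ such that none of $a_1,\ a_2,\ a_3,\ a_1+a_2+a_3$ lies in $\{0,1\}$, and for every such choice $X_a$ is a normal quartic with a double point at $x_1=x_2=x_3=0$, $z=1$, for which $G\equiv 0$, and $|\mathrm{Sing}(X_a)|=14$. -/

import Mathlib

open scoped LinearAlgebra.Projectivization

namespace QuarticSurface

/-- Projective three-space over `K`; the homogeneous coordinates `0, 1, 2, 3` are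
`x₁, x₂, x₃, z`. -/
abbrev P3 (K : Type*) [Field K] : Type _ := ℙ K (Fin 4 → K)

/-- The singular locus of the surface `{F = 0}` in projective three-space: the points where the
form `F` and all its partial derivatives vanish. -/
def Sing {K : Type*} [Field K] (F : MvPolynomial (Fin 4) K) : Set (P3 K) :=
  {p | MvPolynomial.eval p.rep F = 0 ∧
    ∀ i : Fin 4, MvPolynomial.eval p.rep (MvPolynomial.pderiv i F) = 0}

/-- A surface `{F = 0}` in projective three-space is normal when its singular locus is finite. -/
def IsNormalSurface {K : Type*} [Field K] (F : MvPolynomial (Fin 4) K) : Prop :=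
  (Sing F).Finite

/-- The point `x₁ = x₂ = x₃ = 0`, `z = 1`. -/
def origin (K : Type*) [Field K] : P3 K :=
  Projectivization.mk K (Pi.single (3 : Fin 4) (1 : K))
    (fun h => one_ne_zero (Pi.single_eq_zero_iff.mp h))

/-- The form `F` written in the coordinates given by the linear automorphism `A`, that is,
the polynomial of the function `v ↦ F (A v)`. -/
noncomputable def inCoords {K : Type*} [Field K] (A : (Fin 4 → K) ≃ₗ[K] (Fin 4 → K))
    (F : MvPolynomial (Fin 4) K) : MvPolynomial (Fin 4) K :=
  MvPolynomial.bind₁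
    (fun i => ∑ j, MvPolynomial.C (A (Pi.single j 1) i) * MvPolynomial.X j) F

/-- A form in `x₁, x₂, x₃` viewed as a form in `x₁, x₂, x₃, z`. -/
noncomputable def lift {K : Type*} [Field K] (f : MvPolynomial (Fin 3) K) :
    MvPolynomial (Fin 4) K :=
  MvPolynomial.rename Fin.castSucc f

/-- `P` is a double point of the quartic `{F = 0}`, and in the coordinates given by `A`, in which
`P` is the point `x = 0, z = 1`, the form `F` becomes `z² Q(x) + z G(x) + B(x)` with `Q, G, B` forms
of degrees `2, 3, 4` in `x₁, x₂, x₃`. The multiplicity of `P` is exactly two because `Q ≠ 0`, and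
`{Q = 0}` is the tangent cone at `P`. The projection from `P` is `(x, z) ↦ x`. -/
structure IsTaylorAtDoublePoint {K : Type*} [Field K] (F : MvPolynomial (Fin 4) K) (P : P3 K)
    (A : (Fin 4 → K) ≃ₗ[K] (Fin 4 → K)) (Q G B : MvPolynomial (Fin 3) K) : Prop where
  point_eq : P = Projectivization.map A.toLinearMap A.injective (origin K)
  isHomogeneous_Q : Q.IsHomogeneous 2
  isHomogeneous_G : G.IsHomogeneous 3
  isHomogeneous_B : B.IsHomogeneous 4
  Q_ne_zero : Q ≠ 0
  inCoords_eq : inCoords A F =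
    MvPolynomial.X 3 ^ 2 * lift Q + MvPolynomial.X 3 * lift G + lift B

/-- `{Q = 0}` is a double plane (a double line in the projective plane). -/
def IsDoublePlane {K : Type*} [Field K] (Q : MvPolynomial (Fin 3) K) : Prop :=
  ∃ l : MvPolynomial (Fin 3) K, l.IsHomogeneous 1 ∧ l ≠ 0 ∧ Q = l ^ 2

/-- `{Q = 0}` is a union of two distinct planes (two distinct lines in the projective plane). -/
def IsTwoPlanes {K : Type*} [Field K] (Q : MvPolynomial (Fin 3) K) : Prop :=
  ∃ l m : MvPolynomial (Fin 3) K, l.IsHomogeneous 1 ∧ m.IsHomogeneous 1 ∧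
    LinearIndependent K ![l, m] ∧ Q = l * m

/-- The conic `x₁ x₂ + x₃²`. -/
noncomputable def exampleQ (K : Type*) [Field K] : MvPolynomial (Fin 3) K :=
  MvPolynomial.X 0 * MvPolynomial.X 1 + MvPolynomial.X 2 ^ 2

/-- The linear form `y₃ = a₁ x₁ + a₂ x₂ + a₃ x₃`. -/
noncomputable def exampleY {K : Type*} [Field K] (a₁ a₂ a₃ : K) : MvPolynomial (Fin 3) K :=
  MvPolynomial.C a₁ * MvPolynomial.X 0 + MvPolynomial.C a₂ * MvPolynomial.X 1 +
    MvPolynomial.C a₃ * MvPolynomial.X 2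

/-- The product of four lines `(y₃ + x₁) (y₃ + x₂) y₃ (y₃ + x₁ + x₂)`. -/
noncomputable def exampleB {K : Type*} [Field K] (a₁ a₂ a₃ : K) : MvPolynomial (Fin 3) K :=
  (exampleY a₁ a₂ a₃ + MvPolynomial.X 0) * (exampleY a₁ a₂ a₃ + MvPolynomial.X 1) *
    exampleY a₁ a₂ a₃ * (exampleY a₁ a₂ a₃ + MvPolynomial.X 0 + MvPolynomial.X 1)

/-- The quartic form
`z² (x₁ x₂ + x₃²) + (y₃ + x₁) (y₃ + x₂) y₃ (y₃ + x₁ + x₂)`. -/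
noncomputable def exampleF {K : Type*} [Field K] (a₁ a₂ a₃ : K) : MvPolynomial (Fin 4) K :=
  MvPolynomial.X 3 ^ 2 * lift (exampleQ K) + lift (exampleB a₁ a₂ a₃)

/-- The explicit genericity condition on the coefficients: none of `a₁, a₂, a₃, a₁ + a₂ + a₃` is
`0` or `1`. -/
def IsGeneral {K : Type*} [Field K] (a₁ a₂ a₃ : K) : Prop :=
  (a₁ ≠ 0 ∧ a₁ ≠ 1) ∧ (a₂ ≠ 0 ∧ a₂ ≠ 1) ∧ (a₃ ≠ 0 ∧ a₃ ≠ 1) ∧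
    (a₁ + a₂ + a₃ ≠ 0 ∧ a₁ + a₂ + a₃ ≠ 1)

end QuarticSurface

/-!
The surface is `z² Q + B`. As `∂/∂z` of this form vanishes in characteristic two, a point `(x, z)`
with `x ≠ 0` is singular iff `B = w Q` and `∇B = w ∇Q` at `x`, where `w = z²`. If `Q`, `∇Q`, `B`,
`∇B` vanished together at `x`, the whole line joining `x` to `P` would be singular; so, for a normal
surface, `w` is determined by `x`, hence so is `z`, and the singular points other than `P` are in
bijection with their projections to the plane (`encard_Sing_eq`). It remains to bound the number of
these projections, which form the set `projSing Q B`.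

The polar form of `Q` is alternating. If it is zero, then `Q` is the square of a linear form, and
the projections are critical points of `B`: common zeros of three cubics. Otherwise, in coordinates
with its kernel spanned by `(0, 0, 1)`, one has `∇Q = d (x₁, x₀, 0)` with `d ≠ 0`. The projections
then lie on the cubic `∂₂B = 0` and on the quintics `Q ∂₀B + d x₁ B = 0` and
`Q ∂₁B + d x₀ B = 0`; if `Q = x₀ x₁`, they lie on the cubic and on the quartic `x₀ ∂₀B + B = 0`.
In each case the curves meet, up to finitely many points, only in projections of singular points.
So they have finitely many common points, and Bézout's inequality (`encard_zeros_le`) leaves at most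
`9`, `15` and `12` of them, respectively.

Bézout's inequality for two curves without common component follows from a dimension count: the
multiples of the two forms have codimension at most `m n` among the forms of a large degree, while
finitely many points impose independent conditions there. For a finite intersection of several
curves, one replaces all but the first by a general linear combination, which has no component in
common with it, because a common component of all the curves would have infinitely many points.

In the example, `∂₂B = a₃ x₀ x₁ (x₀ + x₁)` confines the projections to three lines through
`(0, 0, 1)`. That point is one of them, and each line carries four others: in terms of the value `y`
of the linear form `y₃` they are `0`, `1` and the two roots of a quadratic polynomial.
-/

namespace QuarticSurface

open MvPolynomial

/-! ### Divisors of forms and the dimension of spaces of forms -/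

theorem eval_smul_of_isHomogeneous {σ R : Type*} [CommSemiring R]
    {f : MvPolynomial σ R} {n : ℕ} (hf : f.IsHomogeneous n) (a : R) (v : σ → R) :
    eval (a • v) f = a ^ n * eval v f := by
  classical
  rw [eval_eq, eval_eq, Finset.mul_sum]
  refine Finset.sum_congr rfl fun d hd => ?_
  have hdeg : d.degree = n := by
    by_contra h
    exact (mem_support_iff.mp hd) (hf.coeff_eq_zero h)
  rw [← hdeg, Finsupp.degree_apply, ← Finset.prod_pow_eq_pow_sum]
  simp only [Pi.smul_apply, smul_eq_mul, mul_pow, Finset.prod_mul_distrib]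
  ring

/-- The substitution `x ↦ t x`, which records the grading by powers of `t`. -/
noncomputable def scaleByT {σ R : Type*} [CommSemiring R] :
    MvPolynomial σ R →ₐ[R] Polynomial (MvPolynomial σ R) :=
  aeval fun i => Polynomial.C (X i) * Polynomial.X

theorem coeff_scaleByT {σ R : Type*} [CommSemiring R] (f : MvPolynomial σ R) (n : ℕ) :
    (scaleByT f).coeff n = homogeneousComponent n f := by
  classical
  induction f using MvPolynomial.induction_on' with
  | monomial d r =>
    have h : scaleByT (monomial d r) = Polynomial.C (monomial d r) * Polynomial.X ^ d.degree := by
      rw [scaleByT, aeval_monomial, monomial_eq (a := r), Finsupp.prod, Finsupp.prod]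
      simp only [mul_pow, Finset.prod_mul_distrib, Finset.prod_pow_eq_pow_sum, map_mul, map_prod,
        map_pow, Finsupp.degree_apply, mul_assoc]
      rfl
    rw [h, Polynomial.coeff_C_mul, Polynomial.coeff_X_pow,
      homogeneousComponent_of_mem (isHomogeneous_monomial r rfl)]
    simp
  | add p q hp hq => rw [map_add, map_add, Polynomial.coeff_add, hp, hq]

theorem scaleByT_of_isHomogeneous {σ R : Type*} [CommSemiring R]
    {f : MvPolynomial σ R} {n : ℕ} (hf : f.IsHomogeneous n) :
    scaleByT f = Polynomial.C f * Polynomial.X ^ n := by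
  ext1 k
  rw [coeff_scaleByT, Polynomial.coeff_C_mul, Polynomial.coeff_X_pow,
    homogeneousComponent_of_mem hf]
  simp

theorem scaleByT_ne_zero {σ R : Type*} [CommSemiring R] {f : MvPolynomial σ R} (hf : f ≠ 0) :
    scaleByT f ≠ 0 := by
  intro h
  apply hf
  rw [← sum_homogeneousComponent f]
  refine Finset.sum_eq_zero fun i _ => ?_
  rw [← coeff_scaleByT, h, Polynomial.coeff_zero]

theorem isHomogeneous_of_scaleByT {σ R : Type*} [CommSemiring R] {f : MvPolynomial σ R}
    (hd : (scaleByT f).natDegree = (scaleByT f).natTrailingDegree) :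
    f.IsHomogeneous (scaleByT f).natDegree := by
  set n := (scaleByT f).natDegree with hn
  have h : f = homogeneousComponent n f := by
    conv_lhs => rw [← sum_homogeneousComponent f]
    rw [Finset.sum_eq_single n]
    · intro k _ hk
      rw [← coeff_scaleByT]
      rcases lt_or_gt_of_ne hk with h | h
      · exact Polynomial.coeff_eq_zero_of_lt_natTrailingDegree (hd ▸ h)
      · exact Polynomial.coeff_eq_zero_of_natDegree_lt h
    · intro hk
      apply homogeneousComponent_eq_zero
      simpa using hk
  rw [h]
  exact homogeneousComponent_isHomogeneous n f

/-- Divisors of a nonzero form are forms: both the lowest and the highest degree are additive under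
multiplication. -/
theorem isHomogeneous_of_mul {σ R : Type*} [CommRing R] [IsDomain R] {p q : MvPolynomial σ R}
    {n : ℕ} (hn : (p * q).IsHomogeneous n) (h0 : p * q ≠ 0) :
    ∃ a b, p.IsHomogeneous a ∧ q.IsHomogeneous b ∧ a + b = n := by
  have hp := scaleByT_ne_zero (left_ne_zero_of_mul h0)
  have hq := scaleByT_ne_zero (right_ne_zero_of_mul h0)
  have hm : scaleByT p * scaleByT q = Polynomial.C (p * q) * Polynomial.X ^ n := by
    rw [← map_mul, scaleByT_of_isHomogeneous hn]
  have h1 := Polynomial.natDegree_mul hp hq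
  have h2 := Polynomial.natTrailingDegree_mul hp hq
  rw [hm, Polynomial.natDegree_C_mul_X_pow _ _ h0] at h1
  rw [hm, Polynomial.C_mul_X_pow_eq_monomial, Polynomial.natTrailingDegree_monomial h0] at h2
  have h3 := Polynomial.natTrailingDegree_le_natDegree (scaleByT p)
  have h4 := Polynomial.natTrailingDegree_le_natDegree (scaleByT q)
  exact ⟨_, _, isHomogeneous_of_scaleByT (by omega), isHomogeneous_of_scaleByT (by omega), h1.symm⟩

theorem finrank_homogeneousSubmodule (K : Type*) [Field K] (n : ℕ) :
    Module.finrank K (homogeneousSubmodule (Fin 3) K n) = (n + 2).choose 2 := by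
  classical
  rw [homogeneousSubmodule_eq_finsupp_supported]
  change Module.finrank K (restrictSupport K _) = _
  rw [Module.finrank_eq_nat_card_basis (basisRestrictSupport K {d : Fin 3 →₀ ℕ | d.degree = n})]
  have h : {d : Fin 3 →₀ ℕ | d.degree = n} =
      ((Finset.univ : Finset (Fin 3)).finsuppAntidiag n : Set (Fin 3 →₀ ℕ)) := by
    ext d
    simp [Finsupp.degree_eq_sum]
  rw [h, Nat.card_coe_set_eq, Set.ncard_coe_finset, Finset.card_finsuppAntidiag_nat_eq_choose]
  simp only [Finset.card_univ, Fintype.card_fin]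
  rw [show 3 + n - 1 = n + 2 by omega, Nat.choose_symm_add]

/-! ### Bézout's inequality -/

/-- The linear form with coefficients `c`. -/
noncomputable def linForm {σ R : Type*} [Fintype σ] [CommSemiring R] (c : σ → R) :
    MvPolynomial σ R :=
  ∑ i, C (c i) * X i

theorem isHomogeneous_linForm {σ R : Type*} [Fintype σ] [CommSemiring R] (c : σ → R) :
    (linForm c).IsHomogeneous 1 :=
  IsHomogeneous.sum _ _ _ fun _ _ => isHomogeneous_C_mul_X _ _

@[simp]
theorem eval_linForm {σ R : Type*} [Fintype σ] [CommSemiring R] (c v : σ → R) :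
    eval v (linForm c) = ∑ i, c i * v i := by
  simp [linForm]

theorem exists_linForm_separating {σ K : Type*} [Fintype σ] [Field K] {p q : ℙ K (σ → K)}
    (h : p ≠ q) :
    ∃ c : σ → K, eval p.rep (linForm c) ≠ 0 ∧ eval q.rep (linForm c) = 0 := by
  classical
  have hnot : p.rep ∉ Submodule.span K {q.rep} := by
    intro hmem
    obtain ⟨a, ha⟩ := Submodule.mem_span_singleton.mp hmem
    apply h
    rw [← p.mk_rep, ← q.mk_rep, Projectivization.mk_eq_mk_iff']
    exact ⟨a, ha⟩
  obtain ⟨φ, h1, h2⟩ := Submodule.exists_dual_map_eq_bot_of_notMem hnot inferInstance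
  have key : ∀ v : σ → K, eval v (linForm fun i => φ (Pi.single i 1)) = φ v := by
    intro v
    rw [eval_linForm]
    conv_rhs => rw [pi_eq_sum_univ' v, map_sum]
    refine Finset.sum_congr rfl fun i _ => ?_
    rw [map_smul, smul_eq_mul, mul_comm]
  refine ⟨fun i => φ (Pi.single i 1), by rwa [key], ?_⟩
  rw [key]
  have : φ q.rep ∈ (Submodule.span K {q.rep}).map φ :=
    Submodule.mem_map_of_mem (Submodule.mem_span_singleton_self _)
  rw [h2] at this
  exact (Submodule.mem_bot K).mp this

theorem exists_linForm_eval_ne_zero {σ K : Type*} [Fintype σ] [Field K] {v : σ → K}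
    (h : v ≠ 0) : ∃ c : σ → K, eval v (linForm c) ≠ 0 := by
  classical
  obtain ⟨i, hi⟩ := Function.ne_iff.mp h
  exact ⟨Pi.single i 1, by simpa [Pi.single_apply] using hi⟩

/-- Forms of degree at least the number of points separate points, by products of linear
forms. -/
theorem exists_form_separating {σ K : Type*} [Fintype σ] [Field K] (S : Finset (ℙ K (σ → K)))
    (p : ℙ K (σ → K)) {d : ℕ} (hd : S.card ≤ d) :
    ∃ f : MvPolynomial σ K, f.IsHomogeneous d ∧ eval p.rep f ≠ 0 ∧
      ∀ q ∈ S, q ≠ p → eval q.rep f = 0 := by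
  classical
  induction S using Finset.induction_on generalizing d with
  | empty =>
    obtain ⟨c, hc⟩ := exists_linForm_eval_ne_zero p.rep_nonzero
    refine ⟨linForm c ^ d, by simpa using (isHomogeneous_linForm c).pow d, ?_, by simp⟩
    rw [map_pow]
    exact pow_ne_zero _ hc
  | insert q S hq ih =>
    rw [Finset.card_insert_of_notMem hq] at hd
    obtain ⟨e, rfl⟩ : ∃ e, d = 1 + e := ⟨d - 1, by omega⟩
    obtain ⟨f, hf, hfp, hfS⟩ := ih (d := e) (by omega)
    obtain ⟨c, hc, hcq⟩ : ∃ c : σ → K, eval p.rep (linForm c) ≠ 0 ∧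
        (q ≠ p → eval q.rep (linForm c) = 0) := by
      by_cases h : q = p
      · obtain ⟨c, hc⟩ := exists_linForm_eval_ne_zero p.rep_nonzero
        exact ⟨c, hc, fun h' => (h' h).elim⟩
      · obtain ⟨c, hc, hcq⟩ := exists_linForm_separating (Ne.symm h)
        exact ⟨c, hc, fun _ => hcq⟩
    refine ⟨linForm c * f, (isHomogeneous_linForm c).mul hf, ?_, ?_⟩
    · rw [map_mul]
      exact mul_ne_zero hc hfp
    · intro r hr hrp
      rw [map_mul]
      rcases Finset.mem_insert.mp hr with rfl | hr
      · rw [hcq hrp, zero_mul]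
      · rw [hfS r hr hrp, mul_zero]

/-- Multiplication by a form of degree `m`, as a map from forms of degree `e` to forms of
degree `d = m + e`. -/
noncomputable def mulForm {σ K : Type*} [Field K] {f : MvPolynomial σ K} {m e d : ℕ}
    (hf : f.IsHomogeneous m) (h : m + e = d) :
    homogeneousSubmodule σ K e →ₗ[K] homogeneousSubmodule σ K d :=
  LinearMap.restrict (LinearMap.mulLeft K f) fun _ ha => h ▸ hf.mul ha

@[simp]
theorem coe_mulForm {σ K : Type*} [Field K] {f : MvPolynomial σ K} {m e d : ℕ}
    (hf : f.IsHomogeneous m) (h : m + e = d) (a : homogeneousSubmodule σ K e) :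
    (mulForm hf h a : MvPolynomial σ K) = f * a :=
  rfl

/-- Evaluation of forms of degree `d` at (representatives of) the points of `S`. -/
noncomputable def evalForm {σ K : Type*} [Field K] (S : Finset (ℙ K (σ → K))) (d : ℕ) :
    homogeneousSubmodule σ K d →ₗ[K] (S → K) :=
  LinearMap.pi fun p => (aeval (R := K) p.1.rep).toLinearMap ∘ₗ Submodule.subtype _

@[simp]
theorem evalForm_apply {σ K : Type*} [Field K] (S : Finset (ℙ K (σ → K))) (d : ℕ)
    (a : homogeneousSubmodule σ K d) (p : S) :
    evalForm S d a p = eval p.1.rep (a : MvPolynomial σ K) := by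
  simp [evalForm]

theorem evalForm_surjective {σ K : Type*} [Fintype σ] [Field K] (S : Finset (ℙ K (σ → K)))
    {d : ℕ} (hd : S.card ≤ d) : Function.Surjective (evalForm S d) := by
  classical
  choose f hf hfp hfS using fun p : S => exists_form_separating S p.1 hd
  intro w
  refine ⟨∑ p : S, (w p / eval p.1.rep (f p)) • ⟨f p, hf p⟩, ?_⟩
  ext q
  rw [map_sum, Finset.sum_apply, Finset.sum_eq_single q]
  · rw [map_smul, Pi.smul_apply, evalForm_apply, smul_eq_mul, div_mul_cancel₀ _ (hfp q)]
  · intro p _ hpq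
    rw [map_smul, Pi.smul_apply, evalForm_apply,
      hfS p q.1 q.2 fun h => hpq (Subtype.ext h.symm), smul_zero]
  · simp

instance finiteDimensional_homogeneousSubmodule {σ K : Type*} [Finite σ] [Field K] (n : ℕ) :
    FiniteDimensional K (homogeneousSubmodule σ K n) :=
  Module.Finite.iff_fg.mpr (homogeneousSubmodule_fg _ _ n)

/-- **Bézout's inequality** for plane curves without common component. In a degree `d` that is large
enough for the points to impose independent conditions on forms of degree `d`, the multiples of `f`
and `g` form a space of codimension at most `m * n`, and all of them vanish at the points. -/
theorem card_le_of_isRelPrime {K : Type*} [Field K] {f g : MvPolynomial (Fin 3) K} {m n : ℕ}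
    (hf : f.IsHomogeneous m) (hg : g.IsHomogeneous n) (hf0 : f ≠ 0) (h : IsRelPrime f g)
    (S : Finset (ℙ K (Fin 3 → K)))
    (hS : ∀ p ∈ S, eval p.rep f = 0 ∧ eval p.rep g = 0) : S.card ≤ m * n := by
  classical
  set e := S.card with he
  let μ : homogeneousSubmodule (Fin 3) K (n + e) × homogeneousSubmodule (Fin 3) K (m + e) →ₗ[K]
      homogeneousSubmodule (Fin 3) K (m + n + e) :=
    (mulForm hf (by omega)).coprod (mulForm hg (by omega))
  let κ : homogeneousSubmodule (Fin 3) K e →ₗ[K]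
      homogeneousSubmodule (Fin 3) K (n + e) × homogeneousSubmodule (Fin 3) K (m + e) :=
    (-mulForm hg rfl).prod (mulForm hf rfl)
  -- The only syzygies between `f` and `g` are the multiples of `(-g, f)`.
  have hker : LinearMap.ker μ ≤ LinearMap.range κ := by
    rintro ⟨a, b⟩ hab
    have hab' : f * (a : MvPolynomial (Fin 3) K) + g * b = 0 := congrArg Subtype.val hab
    obtain ⟨c, hc⟩ : f ∣ (b : MvPolynomial (Fin 3) K) := by
      refine h.dvd_of_dvd_mul_left ⟨-a, ?_⟩
      linear_combination hab'
    have ha : (a : MvPolynomial (Fin 3) K) = -(g * c) := by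
      apply mul_left_cancel₀ hf0
      linear_combination hab' - g * hc
    have hcH : c.IsHomogeneous e := by
      by_cases hc0 : c = 0
      · rw [hc0]
        exact isHomogeneous_zero _ _ _
      · have hb := b.2
        rw [hc] at hb
        obtain ⟨i, j, hi, hj, hij⟩ := isHomogeneous_of_mul hb (mul_ne_zero hf0 hc0)
        have := hi.inj_right hf hf0
        obtain rfl : j = e := by omega
        exact hj
    refine ⟨⟨c, hcH⟩, Prod.ext (Subtype.ext ?_) (Subtype.ext ?_)⟩
    · simpa [κ] using ha.symm
    · simpa [κ] using hc.symm
  have hrange : LinearMap.range μ ≤ LinearMap.ker (evalForm S (m + n + e)) := by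
    rintro _ ⟨⟨a, b⟩, rfl⟩
    rw [LinearMap.mem_ker]
    ext p
    obtain ⟨h1, h2⟩ := hS p.1 p.2
    simp [μ, h1, h2]
  have hev : Module.finrank K (LinearMap.range (evalForm S (m + n + e))) = e := by
    rw [LinearMap.range_eq_top.mpr (evalForm_surjective S (by omega)), finrank_top]
    simp [he]
  have d1 := LinearMap.finrank_range_add_finrank_ker μ
  have d2 := LinearMap.finrank_range_add_finrank_ker (evalForm S (m + n + e))
  have d3 := Submodule.finrank_mono hker
  have d4 := LinearMap.finrank_range_le κ
  have d5 := Submodule.finrank_mono hrange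
  rw [Module.finrank_prod] at d1
  simp only [finrank_homogeneousSubmodule] at d1 d2 d4
  have key : (m + n + e + 2).choose 2 + (e + 2).choose 2 =
      (n + e + 2).choose 2 + (m + e + 2).choose 2 + m * n := by
    have aux : ∀ k : ℕ, ((k + 2).choose 2 : ℚ) = (k + 2) * (k + 1) / 2 := by
      intro k
      rw [Nat.cast_choose_two]
      push_cast
      ring
    have : (((m + n + e + 2).choose 2 + (e + 2).choose 2 : ℕ) : ℚ) =
      (((n + e + 2).choose 2 + (m + e + 2).choose 2 + m * n : ℕ) : ℚ) := by
      push_cast [aux]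
      ring
    exact_mod_cast this
  omega

/-! ### Points on plane curves and finite intersections -/

theorem eval_rep_mk_eq_zero_iff {σ K : Type*} [Field K] {f : MvPolynomial σ K} {n : ℕ}
    (hf : f.IsHomogeneous n) (v : σ → K) (hv : v ≠ 0) :
    eval (Projectivization.mk K v hv).rep f = 0 ↔ eval v f = 0 := by
  obtain ⟨a, ha⟩ := Projectivization.exists_smul_eq_mk_rep K v hv
  rw [← ha, Units.smul_def, eval_smul_of_isHomogeneous hf]
  simp

/-- The restriction of a polynomial to the affine line `t ↦ u + t v`. -/
noncomputable def restrictLine {σ K : Type*} [Field K] (f : MvPolynomial σ K) (u v : σ → K) :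
    Polynomial K :=
  aeval (fun i => Polynomial.C (u i) + Polynomial.C (v i) * Polynomial.X) f

@[simp]
theorem eval_restrictLine {σ K : Type*} [Field K] (f : MvPolynomial σ K) (u v : σ → K) (t : K) :
    (restrictLine f u v).eval t = eval (u + t • v) f := by
  rw [restrictLine]
  induction f using MvPolynomial.induction_on with
  | C r => rw [aeval_C, eval_C, Polynomial.algebraMap_apply, Algebra.algebraMap_self_apply,
      Polynomial.eval_C]
  | add p q hp hq => rw [map_add, Polynomial.eval_add, hp, hq, map_add]
  | mul_X p i hp =>
    rw [map_mul, Polynomial.eval_mul, hp, map_mul, aeval_X, eval_X, Polynomial.eval_add,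
      Polynomial.eval_mul, Polynomial.eval_C, Polynomial.eval_C, Polynomial.eval_X, Pi.add_apply,
      Pi.smul_apply, smul_eq_mul, mul_comm t]

/-- A form of positive degree has a zero on every line of projective space. -/
theorem exists_zero_on_line {σ K : Type*} [Field K] [IsAlgClosed K] {f : MvPolynomial σ K} {n : ℕ}
    (hf : f.IsHomogeneous n) (hn : n ≠ 0) (u v : σ → K) :
    (∃ t : K, eval (u + t • v) f = 0) ∨ eval v f = 0 := by
  by_cases hd : (restrictLine f u v).degree = 0
  · right
    -- Here `f (u + t v)` is a constant `c`, so that `f (s u + v) = c sⁿ`, and `s = 0` gives `0`.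
    obtain ⟨c, hc⟩ : ∃ c, restrictLine f u v = Polynomial.C c :=
      ⟨_, Polynomial.eq_C_of_degree_le_zero hd.le⟩
    have h : restrictLine f v u = Polynomial.C c * Polynomial.X ^ n := by
      apply Polynomial.eq_of_infinite_eval_eq
      refine Set.Infinite.mono ?_ (Set.finite_singleton (0 : K)).infinite_compl
      intro s hs
      have hs : s ≠ 0 := hs
      have h1 : eval (u + s⁻¹ • v) f = c := by rw [← eval_restrictLine, hc, Polynomial.eval_C]
      have h2 : v + s • u = s • (u + s⁻¹ • v) := by
        rw [smul_add, smul_smul, mul_inv_cancel₀ hs, one_smul, add_comm]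
      rw [Set.mem_ofPred_eq, eval_restrictLine, h2, eval_smul_of_isHomogeneous hf, h1, mul_comm,
        Polynomial.eval_mul, Polynomial.eval_C, Polynomial.eval_pow, Polynomial.eval_X]
    have h0 := congrArg (Polynomial.eval 0) h
    rw [eval_restrictLine, zero_smul, add_zero] at h0
    rw [h0, Polynomial.eval_mul, Polynomial.eval_pow, Polynomial.eval_X, zero_pow hn, mul_zero]
  · left
    obtain ⟨t, ht⟩ := IsAlgClosed.exists_root _ hd
    exact ⟨t, by rwa [Polynomial.IsRoot, eval_restrictLine] at ht⟩

/-- Over an infinite field some linear form vanishes at none of finitely many points. -/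
theorem exists_linForm_forall_ne_zero {σ K : Type*} [Fintype σ] [Field K] [Infinite K]
    (S : Finset (ℙ K (σ → K))) :
    ∃ c : σ → K, ∀ p ∈ S, eval p.rep (linForm c) ≠ 0 := by
  classical
  let W : ℙ K (σ → K) → Subspace K (σ → K) := fun p =>
    LinearMap.ker (∑ i, p.rep i • LinearMap.proj (R := K) (φ := fun _ : σ => K) i)
  have hW : ∀ p c, c ∈ W p ↔ eval p.rep (linForm c) = 0 := by
    intro p c
    simp [W, mul_comm]
  have hne := Subspace.biUnion_ne_univ_of_top_notMem (s := S.image W) (by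
    intro h
    obtain ⟨p, _, hp⟩ := Finset.mem_image.mp h
    obtain ⟨c, hc⟩ := exists_linForm_eval_ne_zero p.rep_nonzero
    exact hc ((hW p c).mp (hp ▸ Submodule.mem_top)))
  obtain ⟨c, hc⟩ := (Set.ne_univ_iff_exists_notMem _).mp hne
  refine ⟨c, fun p hp h => hc ?_⟩
  simp only [Set.mem_iUnion]
  exact ⟨W p, Finset.mem_image_of_mem W hp, (hW p c).mpr h⟩

/-- In the projective plane a form of positive degree has a zero on every line. -/
theorem exists_zero_on_linForm {K : Type*} [Field K] [IsAlgClosed K] {f : MvPolynomial (Fin 3) K}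
    {n : ℕ} (hf : f.IsHomogeneous n) (hn : n ≠ 0) (c : Fin 3 → K) :
    ∃ v : Fin 3 → K, v ≠ 0 ∧ eval v (linForm c) = 0 ∧ eval v f = 0 := by
  let φ : (Fin 3 → K) →ₗ[K] K := ∑ i, c i • LinearMap.proj (R := K) (φ := fun _ : Fin 3 => K) i
  have hφ : ∀ v, v ∈ LinearMap.ker φ ↔ eval v (linForm c) = 0 := by
    intro v
    simp [φ]
  have hfin : 1 < Module.finrank K (LinearMap.ker φ) := by
    have h1 := LinearMap.finrank_range_add_finrank_ker φ
    have h2 := Submodule.finrank_le (LinearMap.range φ)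
    simp only [Module.finrank_self, Module.finrank_fin_fun] at h1 h2
    omega
  have : Nontrivial (LinearMap.ker φ) := Module.nontrivial_of_finrank_pos (R := K) (by omega)
  obtain ⟨u, hu⟩ := exists_ne (0 : LinearMap.ker φ)
  obtain ⟨v, hv⟩ := exists_linearIndependent_pair_of_one_lt_finrank hfin hu
  rcases exists_zero_on_line hf hn (u : Fin 3 → K) v with ⟨t, ht⟩ | h
  · refine ⟨(u : Fin 3 → K) + t • v, ?_, (hφ _).mp (u + t • v).2, ht⟩
    intro h0
    have h1 : (1 : K) • u + t • v = 0 := by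
      rw [one_smul]
      exact Subtype.ext h0
    exact one_ne_zero (LinearIndependent.pair_iff.mp hv 1 t h1).1
  · refine ⟨v, fun h0 => ?_, (hφ _).mp v.2, h⟩
    exact hv.ne_zero 1 (Subtype.ext h0)

/-- A plane curve over an algebraically closed field has infinitely many points, for it meets every
line. -/
theorem infinite_zeros {K : Type*} [Field K] [IsAlgClosed K] {f : MvPolynomial (Fin 3) K}
    {n : ℕ} (hf : f.IsHomogeneous n) (hn : n ≠ 0) :
    {p : ℙ K (Fin 3 → K) | eval p.rep f = 0}.Infinite := by
  intro hfin
  obtain ⟨c, hc⟩ := exists_linForm_forall_ne_zero hfin.toFinset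
  obtain ⟨v, hv, h1, h2⟩ := exists_zero_on_linForm hf hn c
  refine hc (Projectivization.mk K v hv) ?_ ?_
  · rw [Set.Finite.mem_toFinset]
    exact (eval_rep_mk_eq_zero_iff hf v hv).mpr h2
  · exact (eval_rep_mk_eq_zero_iff (isHomogeneous_linForm c) v hv).mpr h1

/-- A general linear combination of the `g i` is prime to `f`, if no irreducible factor of `f`
divides all the `g i`. -/
theorem exists_isRelPrime_combination {σ ι K : Type*} [Fintype ι] [Field K] [Infinite K]
    {f : MvPolynomial σ K} (hf : f ≠ 0) (g : ι → MvPolynomial σ K)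
    (h : ∀ p, Irreducible p → p ∣ f → ∃ i, ¬ p ∣ g i) :
    ∃ c : ι → K, IsRelPrime f (∑ i, C (c i) * g i) := by
  classical
  let W : MvPolynomial σ K → Subspace K (ι → K) := fun p =>
    { carrier := {c | p ∣ ∑ i, C (c i) * g i}
      add_mem' := by
        intro a b ha hb
        have := dvd_add ha hb
        rw [← Finset.sum_add_distrib] at this
        simpa only [Set.mem_ofPred_eq, Pi.add_apply, map_add, add_mul] using this
      zero_mem' := by simp
      smul_mem' := by
        intro r a ha
        have := Dvd.dvd.mul_left ha (C r)
        rw [Finset.mul_sum] at this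
        simpa only [Set.mem_ofPred_eq, Pi.smul_apply, smul_eq_mul, map_mul, mul_assoc] using this }
  have hne := Subspace.biUnion_ne_univ_of_top_notMem
    (s := (UniqueFactorizationMonoid.factors f).toFinset.image W) (by
      intro hmem
      obtain ⟨p, hp, htop⟩ := Finset.mem_image.mp hmem
      rw [Multiset.mem_toFinset] at hp
      obtain ⟨i, hi⟩ := h p (UniqueFactorizationMonoid.irreducible_of_factor p hp)
        (UniqueFactorizationMonoid.dvd_of_mem_factors hp)
      have hmem : (Pi.single i 1 : ι → K) ∈ W p := htop ▸ Submodule.mem_top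
      have hmem : p ∣ ∑ j, C ((Pi.single i 1 : ι → K) j) * g j := hmem
      rw [Finset.sum_eq_single i (fun j _ hj => by simp [Pi.single_eq_of_ne hj]) (by simp)] at hmem
      exact hi (by simpa using hmem))
  obtain ⟨c, hc⟩ := (Set.ne_univ_iff_exists_notMem _).mp hne
  refine ⟨c, ?_⟩
  refine WfDvdMonoid.isRelPrime_of_no_irreducible_factors (fun h0 => hf h0.1)
    fun p hp hpf hpg => ?_
  obtain ⟨q, hq, hpq⟩ := UniqueFactorizationMonoid.exists_mem_factors_of_dvd hf hp hpf
  apply hc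
  simp only [Set.mem_iUnion]
  refine ⟨W q, Finset.mem_image_of_mem W (Multiset.mem_toFinset.mpr hq), ?_⟩
  exact hpq.symm.dvd.trans hpg

/-- Bézout's inequality for a finite intersection of a curve of degree `m` with any number of curves
of degree `n`. -/
theorem encard_zeros_le {ι K : Type*} [Fintype ι] [Field K] [IsAlgClosed K]
    {f : MvPolynomial (Fin 3) K} {g : ι → MvPolynomial (Fin 3) K} {m n : ℕ}
    (hf : f.IsHomogeneous m) (hg : ∀ i, (g i).IsHomogeneous n) (hf0 : f ≠ 0)
    (hfin : {p : ℙ K (Fin 3 → K) | eval p.rep f = 0 ∧ ∀ i, eval p.rep (g i) = 0}.Finite) :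
    {p : ℙ K (Fin 3 → K) | eval p.rep f = 0 ∧ ∀ i, eval p.rep (g i) = 0}.encard ≤ (m * n : ℕ) := by
  have : Infinite K := IsAlgClosed.instInfinite
  obtain ⟨c, hc⟩ := exists_isRelPrime_combination hf0 g (by
    rintro p hp ⟨q, rfl⟩
    by_contra! hdvd
    obtain ⟨a, b, ha, _, _⟩ := isHomogeneous_of_mul hf hf0
    have ha0 : a ≠ 0 := by
      rintro rfl
      have h1 := totalDegree_eq_zero_iff_eq_C.mp ((totalDegree_zero_iff_isHomogeneous _).mpr ha)
      apply hp.not_isUnit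
      rw [h1]
      refine IsUnit.map C (isUnit_iff_ne_zero.mpr fun h0 => ?_)
      rw [h0, map_zero] at h1
      exact hp.ne_zero h1
    refine infinite_zeros ha ha0 (hfin.subset fun x hx => ⟨?_, fun i => ?_⟩)
    · have hx : eval x.rep p = 0 := hx
      rw [map_mul, hx, zero_mul]
    · have hx : eval x.rep p = 0 := hx
      obtain ⟨r, hr⟩ := hdvd i
      rw [hr, map_mul, hx, zero_mul])
  rw [hfin.encard_eq_coe_toFinset_card, Nat.cast_le]
  refine card_le_of_isRelPrime hf
    (IsHomogeneous.sum _ _ _ fun i _ => (hg i).C_mul (c i)) hf0 hc _ fun p hp => ?_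
  rw [Set.Finite.mem_toFinset] at hp
  refine ⟨hp.1, ?_⟩
  rw [map_sum]
  exact Finset.sum_eq_zero fun i _ => by rw [map_mul, hp.2 i, mul_zero]

/-! ### Linear changes of coordinates and projections of singular points -/

/-- The polynomial of the function `v ↦ f (A v)`. -/
noncomputable def linSubst {σ K : Type*} [Fintype σ] [DecidableEq σ] [Field K]
    (A : (σ → K) ≃ₗ[K] (σ → K)) : MvPolynomial σ K →ₐ[K] MvPolynomial σ K :=
  bind₁ fun i => ∑ j, C (A (Pi.single j 1) i) * X j

theorem sum_apply_single_mul {σ K : Type*} [Fintype σ] [DecidableEq σ] [Field K]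
    (A : (σ → K) ≃ₗ[K] (σ → K)) (v : σ → K) (i : σ) :
    ∑ j, A (Pi.single j 1) i * v j = A v i := by
  conv_rhs => rw [pi_eq_sum_univ' v, map_sum, Finset.sum_apply]
  refine Finset.sum_congr rfl fun j _ => ?_
  rw [map_smul, Pi.smul_apply, smul_eq_mul, mul_comm]

section linSubst

variable {σ K : Type*} [Fintype σ] [DecidableEq σ] [Field K] (A : (σ → K) ≃ₗ[K] (σ → K))

@[simp]
theorem eval_linSubst (f : MvPolynomial σ K) (v : σ → K) :
    eval v (linSubst A f) = eval (A v) f := by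
  rw [linSubst, ← coe_aeval_eq_eval, RingHom.coe_coe, aeval_bind₁, ← coe_aeval_eq_eval,
    RingHom.coe_coe]
  congr 2
  ext i
  simp [sum_apply_single_mul]

theorem isHomogeneous_linSubst {f : MvPolynomial σ K} {n : ℕ} (hf : f.IsHomogeneous n) :
    (linSubst A f).IsHomogeneous n := by
  have := hf.aeval (fun i => ∑ j, C (A (Pi.single j 1) i) * X j)
    (fun i => isHomogeneous_linForm fun j => A (Pi.single j 1) i)
  rwa [one_mul] at this

theorem pderiv_linSubst (f : MvPolynomial σ K) (j : σ) :
    pderiv j (linSubst A f) = ∑ i, C (A (Pi.single j 1) i) * linSubst A (pderiv i f) := by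
  induction f using MvPolynomial.induction_on with
  | C r => simp [linSubst]
  | add p q hp hq =>
    simp only [map_add, hp, hq, mul_add, Finset.sum_add_distrib]
  | mul_X p k hp =>
    have hX : pderiv j (linSubst A (X k)) = C (A (Pi.single j 1) k) := by
      simp [linSubst, pderiv_X, Pi.single_apply]
    rw [map_mul, pderiv_mul, hp, hX]
    simp only [pderiv_mul, pderiv_X, map_add, map_mul, mul_add, Finset.sum_add_distrib,
      Finset.sum_mul]
    congr 1
    · exact Finset.sum_congr rfl fun i _ => by ring
    · rw [Finset.sum_eq_single k]
      · rw [Pi.single_eq_same, map_one]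
        ring
      · intro i _ hi
        rw [Pi.single_eq_of_ne hi.symm, map_zero]
        ring
      · simp

/-- A covector is determined by its pullback under a linear automorphism. -/
theorem forall_sum_apply_single_mul_eq_iff {a b : σ → K} :
    (∀ j, ∑ i, A (Pi.single j 1) i * a i = ∑ i, A (Pi.single j 1) i * b i) ↔ ∀ i, a i = b i := by
  refine ⟨fun h i => ?_, fun h j => by simp only [h]⟩
  have key : ∀ v, ∑ i, A v i * a i = ∑ i, A v i * b i := by
    have expand : ∀ (v c : σ → K),
        ∑ i, A v i * c i = ∑ j, v j * ∑ i, A (Pi.single j 1) i * c i := by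
      intro v c
      simp_rw [← sum_apply_single_mul A v, Finset.sum_mul, Finset.mul_sum]
      rw [Finset.sum_comm]
      exact Finset.sum_congr rfl fun j _ => Finset.sum_congr rfl fun i _ => by ring
    intro v
    simp_rw [expand v, h]
  have := key (A.symm (Pi.single i 1))
  simpa [Pi.single_apply] using this

/-- A linear change of coordinates preserves proportionality of gradients. -/
theorem forall_eval_pderiv_linSubst_eq_iff (f g : MvPolynomial σ K) (v : σ → K) (w : K) :
    (∀ j, eval v (pderiv j (linSubst A f)) = w * eval v (pderiv j (linSubst A g))) ↔
      ∀ i, eval (A v) (pderiv i f) = w * eval (A v) (pderiv i g) := by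
  refine Iff.trans (forall_congr' fun j => ?_) (forall_sum_apply_single_mul_eq_iff A)
  simp only [pderiv_linSubst, map_sum, map_mul, eval_C, eval_linSubst, Finset.mul_sum]
  simp only [mul_left_comm]

theorem forall_eval_pderiv_linSubst_eq_zero_iff (f : MvPolynomial σ K) (v : σ → K) :
    (∀ j, eval v (pderiv j (linSubst A f)) = 0) ↔ ∀ i, eval (A v) (pderiv i f) = 0 := by
  simpa using forall_eval_pderiv_linSubst_eq_iff A f 0 v 0

end linSubst

/-- The line joining the origin (the point `x = 0`, `z = 1`) to `(v, 0)` carries a further singular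
point of `z² Q + B`. In characteristic two the point `(v, z)` is singular iff `B = w Q` and
`∇B = w ∇Q` at `v` with `w = z²`, and every `w` is a square over an algebraically closed field. -/
def IsSingDir {σ K : Type*} [Field K] (Q B : MvPolynomial σ K) (v : σ → K) : Prop :=
  ∃ w : K, eval v B = w * eval v Q ∧ ∀ i, eval v (pderiv i B) = w * eval v (pderiv i Q)

/-- The image of the singular points of `z² Q + B` other than the origin under the projection
`(x, z) ↦ x`. -/
def projSing {σ K : Type*} [Field K] (Q B : MvPolynomial σ K) : Set (ℙ K (σ → K)) :=
  {p | IsSingDir Q B p.rep}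

/-- No line through the origin consists of singular points of `z² Q + B`: there is no point of the
plane at which `Q`, `B` and their gradients all vanish. -/
def NoSingLine {σ K : Type*} [Field K] (Q B : MvPolynomial σ K) : Prop :=
  ∀ v : σ → K, v ≠ 0 → eval v Q = 0 → (∀ i, eval v (pderiv i Q) = 0) → eval v B = 0 →
    ¬ ∀ i, eval v (pderiv i B) = 0

theorem isSingDir_smul {σ K : Type*} [Field K] {Q B : MvPolynomial σ K} (hQ : Q.IsHomogeneous 2)
    (hB : B.IsHomogeneous 4) {a : K} (ha : a ≠ 0) (v : σ → K) :
    IsSingDir Q B (a • v) ↔ IsSingDir Q B v := by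
  have hQ1 : ∀ i, (pderiv i Q).IsHomogeneous 1 := fun i => hQ.pderiv
  have hB1 : ∀ i, (pderiv i B).IsHomogeneous 3 := fun i => hB.pderiv
  simp only [IsSingDir, eval_smul_of_isHomogeneous hQ, eval_smul_of_isHomogeneous hB,
    eval_smul_of_isHomogeneous (hQ1 _), eval_smul_of_isHomogeneous (hB1 _)]
  constructor
  · rintro ⟨w, h1, h2⟩
    refine ⟨w / a ^ 2, ?_, fun i => ?_⟩
    · rw [div_mul_eq_mul_div, eq_div_iff (pow_ne_zero 2 ha)]
      apply mul_left_cancel₀ (pow_ne_zero 2 ha)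
      linear_combination h1
    · rw [div_mul_eq_mul_div, eq_div_iff (pow_ne_zero 2 ha)]
      apply mul_left_cancel₀ ha
      linear_combination h2 i
  · rintro ⟨w, h1, h2⟩
    exact ⟨w * a ^ 2, by rw [h1]; ring, fun i => by rw [h2]; ring⟩

theorem mk_mem_projSing {σ K : Type*} [Field K] {Q B : MvPolynomial σ K} (hQ : Q.IsHomogeneous 2)
    (hB : B.IsHomogeneous 4) (v : σ → K) (hv : v ≠ 0) :
    Projectivization.mk K v hv ∈ projSing Q B ↔ IsSingDir Q B v := by
  obtain ⟨a, ha⟩ := Projectivization.exists_smul_eq_mk_rep K v hv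
  rw [projSing, Set.mem_ofPred_eq, ← ha, Units.smul_def, isSingDir_smul hQ hB a.ne_zero]

section linSubst

variable {σ K : Type*} [Fintype σ] [DecidableEq σ] [Field K] (A : (σ → K) ≃ₗ[K] (σ → K))

theorem isSingDir_linSubst (Q B : MvPolynomial σ K) (v : σ → K) :
    IsSingDir (linSubst A Q) (linSubst A B) v ↔ IsSingDir Q B (A v) := by
  simp only [IsSingDir, eval_linSubst, forall_eval_pderiv_linSubst_eq_iff]

theorem noSingLine_linSubst {Q B : MvPolynomial σ K} (h : NoSingLine Q B) :
    NoSingLine (linSubst A Q) (linSubst A B) := by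
  intro v hv
  simp only [eval_linSubst, forall_eval_pderiv_linSubst_eq_zero_iff]
  exact h (A v) (by simpa using hv)

theorem image_projSing_linSubst {Q B : MvPolynomial σ K} (hQ : Q.IsHomogeneous 2)
    (hB : B.IsHomogeneous 4) :
    Projectivization.map A.toLinearMap A.injective '' projSing (linSubst A Q) (linSubst A B) =
      projSing Q B := by
  ext p
  constructor
  · rintro ⟨q, hq, rfl⟩
    rw [← q.mk_rep, Projectivization.map_mk, mk_mem_projSing hQ hB]
    exact (isSingDir_linSubst A Q B _).mp hq
  · intro hp
    have hne : A.symm p.rep ≠ 0 := by simpa using p.rep_nonzero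
    refine ⟨Projectivization.mk K (A.symm p.rep) hne, ?_, ?_⟩
    · rw [mk_mem_projSing (isHomogeneous_linSubst A hQ) (isHomogeneous_linSubst A hB),
        isSingDir_linSubst, LinearEquiv.apply_symm_apply]
      exact hp
    · rw [Projectivization.map_mk]
      conv_rhs => rw [← p.mk_rep]
      simp

theorem encard_projSing_linSubst {Q B : MvPolynomial σ K} (hQ : Q.IsHomogeneous 2)
    (hB : B.IsHomogeneous 4) :
    (projSing (linSubst A Q) (linSubst A B)).encard = (projSing Q B).encard := by
  rw [← image_projSing_linSubst A hQ hB,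
    (Projectivization.map_injective A.toLinearMap A.injective).injOn.encard_image]

theorem finite_projSing_linSubst {Q B : MvPolynomial σ K} (hQ : Q.IsHomogeneous 2)
    (hB : B.IsHomogeneous 4) (h : (projSing Q B).Finite) :
    (projSing (linSubst A Q) (linSubst A B)).Finite := by
  rwa [← Set.encard_lt_top_iff, encard_projSing_linSubst A hQ hB, Set.encard_lt_top_iff]

end linSubst

theorem exists_linForm_eq {σ K : Type*} [Fintype σ] [Field K] {f : MvPolynomial σ K}
    (hf : f.IsHomogeneous 1) : ∃ c, f = linForm c := by
  rw [← mem_homogeneousSubmodule, homogeneousSubmodule_one_eq_span_X,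
    Submodule.mem_span_range_iff_exists_fun] at hf
  obtain ⟨c, rfl⟩ := hf
  exact ⟨c, by simp [linForm, smul_eq_C_mul]⟩

/-- The term of a quadratic form with coefficient `b i` is the product of the two coordinates other
than the `i`-th. -/
theorem exists_quadratic_eq {K : Type*} [Field K] {f : MvPolynomial (Fin 3) K}
    (hf : f.IsHomogeneous 2) : ∃ a b : Fin 3 → K,
      f = C (a 0) * X 0 ^ 2 + C (a 1) * X 1 ^ 2 + C (a 2) * X 2 ^ 2 +
        C (b 0) * X 1 * X 2 + C (b 1) * X 0 * X 2 + C (b 2) * X 0 * X 1 := by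
  rw [← mem_homogeneousSubmodule, ← homogeneousSubmodule_one_pow, pow_two] at hf
  induction hf using Submodule.mul_induction_on' with
  | mem_mul_mem m hm n hn =>
    obtain ⟨c, rfl⟩ := exists_linForm_eq hm
    obtain ⟨d, rfl⟩ := exists_linForm_eq hn
    refine ⟨fun i => c i * d i, ![c 1 * d 2 + c 2 * d 1, c 0 * d 2 + c 2 * d 0,
      c 0 * d 1 + c 1 * d 0], ?_⟩
    simp only [linForm, Fin.sum_univ_three, map_mul, map_add, Matrix.cons_val]
    ring
  | add x hx y hy ihx ihy =>
    obtain ⟨a, b, rfl⟩ := ihx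
    obtain ⟨a', b', rfl⟩ := ihy
    refine ⟨a + a', b + b', ?_⟩
    simp only [Pi.add_apply, map_add]
    ring

/-- Two independent linear forms are coordinates. -/
theorem exists_linSubst_pair {K : Type*} [Field K] [Infinite K] {c d : Fin 3 → K}
    (h : LinearIndependent K ![c, d]) :
    ∃ A : (Fin 3 → K) ≃ₗ[K] (Fin 3 → K), linSubst A (linForm c) = X 0 ∧
      linSubst A (linForm d) = X 1 := by
  obtain ⟨e, he⟩ := exists_linearIndependent_snoc_of_lt_finrank h (by simp)
  let M : Matrix (Fin 3) (Fin 3) K := Matrix.of (Fin.snoc (α := fun _ => Fin 3 → K) ![c, d] e)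
  have hM : IsUnit M := Matrix.linearIndependent_rows_iff_isUnit.mp he
  have hdet : IsUnit M.det := (Matrix.isUnit_iff_isUnit_det M).mp hM
  let E := Matrix.toLinearEquiv' M (M.invertibleOfIsUnitDet hdet)
  have hE : ∀ v i, ∑ j, M i j * v j = E v i := fun v i => rfl
  refine ⟨E.symm, MvPolynomial.funext fun v => ?_, MvPolynomial.funext fun v => ?_⟩
  · rw [eval_linSubst, eval_linForm, eval_X]
    conv_rhs => rw [← E.apply_symm_apply v, ← hE]
    rfl
  · rw [eval_linSubst, eval_linForm, eval_X]
    conv_rhs => rw [← E.apply_symm_apply v, ← hE]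
    rfl

theorem exists_linearEquiv_apply_single_two {K : Type*} [Field K] {k : Fin 3 → K} (hk : k ≠ 0) :
    ∃ A : (Fin 3 → K) ≃ₗ[K] (Fin 3 → K), A (Pi.single 2 1) = k := by
  have h1 : LinearIndependent K ![k] := LinearIndependent.of_subsingleton 0 hk
  obtain ⟨c, hc⟩ := exists_linearIndependent_cons_of_lt_finrank h1 (by simp)
  obtain ⟨d, hd⟩ := exists_linearIndependent_cons_of_lt_finrank hc (by simp)
  let b := basisOfLinearIndependentOfCardEqFinrank hd (by simp)
  refine ⟨b.equivFun.symm, ?_⟩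
  rw [Module.Basis.equivFun_symm_apply, Finset.sum_eq_single 2]
  · simp [b]
  · intro i _ hi
    simp [hi]
  · simp

/-! ### Bounds for the projected singular locus -/

theorem projectivization_eq_mk_single_two {K : Type*} [Field K] {p : ℙ K (Fin 3 → K)}
    (h0 : p.rep 0 = 0) (h1 : p.rep 1 = 0) :
    p = Projectivization.mk K (Pi.single 2 1) (by simp) := by
  conv_lhs => rw [← p.mk_rep]
  rw [Projectivization.mk_eq_mk_iff']
  refine ⟨p.rep 2, ?_⟩
  ext i
  fin_cases i <;> simp [h0, h1]

section CharTwo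

variable {K : Type*} [Field K] [CharP K 2]

/-- Euler's identity for a form of degree four vanishes in characteristic two. -/
theorem sum_X_mul_pderiv_eq_zero {B : MvPolynomial (Fin 3) K} (hB : B.IsHomogeneous 4) :
    X 0 * pderiv 0 B + X 1 * pderiv 1 B + X 2 * pderiv 2 B = 0 := by
  have h := hB.sum_X_mul_pderiv
  rw [Fin.sum_univ_three] at h
  rw [h, show (4 : ℕ) = 2 * 2 from rfl, mul_nsmul, CharTwo.two_nsmul]

theorem eval_sum_mul_pderiv_eq_zero {B : MvPolynomial (Fin 3) K} (hB : B.IsHomogeneous 4)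
    (v : Fin 3 → K) :
    v 0 * eval v (pderiv 0 B) + v 1 * eval v (pderiv 1 B) + v 2 * eval v (pderiv 2 B) = 0 := by
  simpa using congrArg (eval v) (sum_X_mul_pderiv_eq_zero hB)

/-- In characteristic two the squares do not contribute to the gradient of a quadratic form, which
is the cross product with `b`. -/
theorem pderiv_quadratic (a b : Fin 3 → K) {Q : MvPolynomial (Fin 3) K}
    (h : Q = C (a 0) * X 0 ^ 2 + C (a 1) * X 1 ^ 2 + C (a 2) * X 2 ^ 2 +
        C (b 0) * X 1 * X 2 + C (b 1) * X 0 * X 2 + C (b 2) * X 0 * X 1) :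
    pderiv 0 Q = C (b 2) * X 1 + C (b 1) * X 2 ∧ pderiv 1 Q = C (b 2) * X 0 + C (b 0) * X 2 ∧
      pderiv 2 Q = C (b 1) * X 0 + C (b 0) * X 1 := by
  have two' : (2 : MvPolynomial (Fin 3) K) = 0 := CharTwo.two_eq_zero
  subst h
  refine ⟨?_, ?_, ?_⟩ <;>
  · simp [pderiv_X, two']
    ring

variable [IsAlgClosed K]

/-- The case of a nonzero polar form, in coordinates with `(0, 0, 1)` in its kernel: the projections
lie on the cubic `∂₂B = 0` and on two quintics, and the only further point these curves may have in
common is `(0, 0, 1)`. -/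
theorem encard_projSing_le_of_pderiv {Q B : MvPolynomial (Fin 3) K} (hQ : Q.IsHomogeneous 2)
    (hB : B.IsHomogeneous 4) {d : K} (hd : d ≠ 0) (h0 : pderiv 0 Q = C d * X 1)
    (h1 : pderiv 1 Q = C d * X 0) (h2 : pderiv 2 Q = 0) (hfin : (projSing Q B).Finite) :
    (projSing Q B).encard ≤ 15 := by
  have two : (2 : K) = 0 := CharTwo.two_eq_zero
  have hB1 : ∀ i, (pderiv i B).IsHomogeneous 3 := fun i => hB.pderiv
  have hsing : ∀ v, IsSingDir Q B v ↔ ∃ w : K, eval v B = w * eval v Q ∧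
      eval v (pderiv 0 B) = w * (d * v 1) ∧ eval v (pderiv 1 B) = w * (d * v 0) ∧
        eval v (pderiv 2 B) = 0 := by
    intro v
    simp [IsSingDir, Fin.forall_fin_succ, h0, h1, h2]
  by_cases hB2 : pderiv 2 B = 0
  · -- Here `∇B = c (x₁, x₀, 0)`, and the curve `Q c + d B = 0` lies in the finite set.
    exfalso
    obtain ⟨c, hc0, hc1, hc⟩ : ∃ c : MvPolynomial (Fin 3) K, pderiv 0 B = X 1 * c ∧
        pderiv 1 B = X 0 * c ∧ c.IsHomogeneous 2 := by
      have he := sum_X_mul_pderiv_eq_zero hB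
      rw [hB2, mul_zero, add_zero] at he
      have hX : Irreducible (X 1 : MvPolynomial (Fin 3) K) := (X_prime (i := 1)).irreducible
      have hrel : IsRelPrime (X 1 : MvPolynomial (Fin 3) K) (X 0) :=
        hX.isRelPrime_iff_not_dvd.mpr fun h => by simp [X_dvd_X] at h
      obtain ⟨c, hc⟩ : (X 1 : MvPolynomial (Fin 3) K) ∣ pderiv 0 B :=
        hrel.dvd_of_dvd_mul_left ⟨-pderiv 1 B, by linear_combination he⟩
      refine ⟨c, hc, ?_, ?_⟩
      · apply mul_left_cancel₀ (X_ne_zero (R := K) (1 : Fin 3))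
        rw [hc] at he
        have two' : (2 : MvPolynomial (Fin 3) K) = 0 := CharTwo.two_eq_zero
        linear_combination he - X 0 * X 1 * c * two'
      · by_cases hc0 : c = 0
        · rw [hc0]
          exact isHomogeneous_zero _ _ _
        · have h3 := hB1 0
          rw [hc] at h3
          have hX0 := X_ne_zero (R := K) (1 : Fin 3)
          obtain ⟨i, j, hi, hj, hij⟩ := isHomogeneous_of_mul h3 (mul_ne_zero hX0 hc0)
          have := hi.inj_right (isHomogeneous_X K 1) hX0
          obtain rfl : j = 2 := by omega
          exact hj
    refine infinite_zeros ((hQ.mul hc).add (hB.C_mul d)) (by norm_num) (hfin.subset ?_)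
    intro p hp
    have hp : eval p.rep (Q * c + C d * B) = 0 := hp
    simp only [map_add, map_mul, eval_C] at hp
    refine (hsing _).mpr ⟨eval p.rep c / d, ?_, ?_, ?_, ?_⟩
    · field_simp
      linear_combination hp - eval p.rep Q * eval p.rep c * two
    · rw [hc0]
      simp
      field_simp
    · rw [hc1]
      simp
      field_simp
    · rw [hB2, map_zero]
  · set g : Fin 2 → MvPolynomial (Fin 3) K :=
      ![Q * pderiv 0 B + C d * X 1 * B, Q * pderiv 1 B + C d * X 0 * B] with hg
    have hgh : ∀ i, (g i).IsHomogeneous 5 := by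
      intro i
      fin_cases i
      · exact (hQ.mul (hB1 0)).add ((isHomogeneous_C_mul_X d 1).mul hB)
      · exact (hQ.mul (hB1 1)).add ((isHomogeneous_C_mul_X d 0).mul hB)
    have hmem : ∀ v : Fin 3 → K, (eval v (pderiv 2 B) = 0 ∧ ∀ i, eval v (g i) = 0) ↔
        eval v (pderiv 2 B) = 0 ∧ eval v Q * eval v (pderiv 0 B) + d * v 1 * eval v B = 0 ∧
          eval v Q * eval v (pderiv 1 B) + d * v 0 * eval v B = 0 := by
      intro v
      simp [hg, Fin.forall_fin_two]
    have hsub : projSing Q B ⊆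
        {p : ℙ K (Fin 3 → K) | eval p.rep (pderiv 2 B) = 0 ∧ ∀ i, eval p.rep (g i) = 0} := by
      intro p hp
      obtain ⟨w, hw, e0, e1, e2⟩ := (hsing _).mp hp
      refine (hmem _).mpr ⟨e2, ?_, ?_⟩
      · rw [hw, e0]
        linear_combination d * p.rep 1 * w * eval p.rep Q * two
      · rw [hw, e1]
        linear_combination d * p.rep 0 * w * eval p.rep Q * two
    have hsup : {p : ℙ K (Fin 3 → K) | eval p.rep (pderiv 2 B) = 0 ∧ ∀ i, eval p.rep (g i) = 0} ⊆
        insert (Projectivization.mk K (Pi.single 2 1) (by simp)) (projSing Q B) := by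
      intro p hp
      obtain ⟨e2, e0, e1⟩ := (hmem _).mp hp
      rw [Set.mem_insert_iff, or_iff_not_imp_left]
      intro hne
      refine (hsing _).mpr ?_
      have hE := eval_sum_mul_pderiv_eq_zero hB p.rep
      rw [e2, mul_zero, add_zero] at hE
      by_cases hQ0 : eval p.rep Q = 0
      · rw [hQ0] at e0 e1
        by_cases hx0 : p.rep 0 = 0
        · have hx1 : p.rep 1 ≠ 0 := fun hx1 => hne (projectivization_eq_mk_single_two hx0 hx1)
          have hB0 : eval p.rep B = 0 := by simpa [hd, hx1] using e0
          refine ⟨eval p.rep (pderiv 0 B) / (d * p.rep 1), by simp [hQ0, hB0], ?_, ?_, e2⟩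
          · field_simp
          · simpa [hx0, hx1] using hE
        · have hB0 : eval p.rep B = 0 := by simpa [hd, hx0] using e1
          refine ⟨eval p.rep (pderiv 1 B) / (d * p.rep 0), by simp [hQ0, hB0], ?_, ?_, e2⟩
          · field_simp
            linear_combination hE - p.rep 1 * eval p.rep (pderiv 1 B) * two
          · field_simp
      · refine ⟨eval p.rep B / eval p.rep Q, ?_, ?_, ?_, e2⟩
        · field_simp
        · field_simp
          linear_combination e0 - d * p.rep 1 * eval p.rep B * two
        · field_simp
          linear_combination e1 - d * p.rep 0 * eval p.rep B * two
    exact (Set.encard_le_encard hsub).trans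
      (encard_zeros_le (hB1 2) hgh hB2 ((hfin.insert _).subset hsup))

/-- The case of two planes: the projections lie on the cubic `∂₂B = 0` and on the quartic
`x₀ ∂₀B + B = 0`. -/
theorem encard_projSing_X_mul_X_le {B : MvPolynomial (Fin 3) K} (hB : B.IsHomogeneous 4)
    (hfin : (projSing (X 0 * X 1) B).Finite) : (projSing (X 0 * X 1) B).encard ≤ 12 := by
  have two : (2 : K) = 0 := CharTwo.two_eq_zero
  have hB1 : ∀ i, (pderiv i B).IsHomogeneous 3 := fun i => hB.pderiv
  have hsing : ∀ v, IsSingDir (X 0 * X 1) B v ↔ ∃ w : K, eval v B = w * (v 0 * v 1) ∧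
      eval v (pderiv 0 B) = w * v 1 ∧ eval v (pderiv 1 B) = w * v 0 ∧
        eval v (pderiv 2 B) = 0 := by
    intro v
    simp [IsSingDir, Fin.forall_fin_succ, pderiv_X, Pi.single_apply]
  set g : Unit → MvPolynomial (Fin 3) K := fun _ => X 0 * pderiv 0 B + B with hg
  have hgh : ∀ i, (g i).IsHomogeneous 4 := fun _ => ((isHomogeneous_X K 0).mul (hB1 0)).add hB
  have hmem : ∀ v : Fin 3 → K, (eval v (pderiv 2 B) = 0 ∧ ∀ i, eval v (g i) = 0) ↔
      eval v (pderiv 2 B) = 0 ∧ v 0 * eval v (pderiv 0 B) + eval v B = 0 := by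
    intro v
    simp [hg]
  have hsub : projSing (X 0 * X 1) B ⊆
      {p : ℙ K (Fin 3 → K) | eval p.rep (pderiv 2 B) = 0 ∧ ∀ i, eval p.rep (g i) = 0} := by
    intro p hp
    obtain ⟨w, hw, e0, e1, e2⟩ := (hsing _).mp hp
    refine (hmem _).mpr ⟨e2, ?_⟩
    rw [hw, e0]
    linear_combination p.rep 0 * p.rep 1 * w * two
  have hsup : {p : ℙ K (Fin 3 → K) | eval p.rep (pderiv 2 B) = 0 ∧ ∀ i, eval p.rep (g i) = 0} ⊆
      insert (Projectivization.mk K (Pi.single 2 1) (by simp)) (projSing (X 0 * X 1) B) := by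
    intro p hp
    obtain ⟨e2, e0⟩ := (hmem _).mp hp
    rw [Set.mem_insert_iff, or_iff_not_imp_left]
    intro hne
    refine (hsing _).mpr ?_
    have hE := eval_sum_mul_pderiv_eq_zero hB p.rep
    rw [e2, mul_zero, add_zero] at hE
    by_cases hx0 : p.rep 0 = 0
    · have hx1 : p.rep 1 ≠ 0 := fun hx1 => hne (projectivization_eq_mk_single_two hx0 hx1)
      refine ⟨eval p.rep (pderiv 0 B) / p.rep 1, ?_, ?_, ?_, e2⟩
      · simpa [hx0] using e0
      · field_simp
      · simpa [hx0, hx1] using hE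
    · refine ⟨eval p.rep (pderiv 1 B) / p.rep 0, ?_, ?_, ?_, e2⟩
      · field_simp
        linear_combination e0 - hE
      · field_simp
        linear_combination hE - p.rep 1 * eval p.rep (pderiv 1 B) * two
      · field_simp
  have hV := (hfin.insert _).subset hsup
  have hB2 : pderiv 2 B ≠ 0 := by
    intro hB2
    refine infinite_zeros (hgh ()) (by norm_num) (hV.subset fun p hp => ?_)
    exact ⟨by rw [hB2, map_zero], fun _ => hp⟩
  exact (Set.encard_le_encard hsub).trans (encard_zeros_le (hB1 2) hgh hB2 hV)

/-- The case of a double plane: the projections are the critical points of `B` off the line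
`x₀ = 0`, and only finitely many critical points lie on that line. -/
theorem encard_projSing_X_sq_le {B : MvPolynomial (Fin 3) K} (hB : B.IsHomogeneous 4)
    (hN : NoSingLine (X 0 ^ 2) B) (hfin : (projSing (X 0 ^ 2) B).Finite) :
    (projSing (X 0 ^ 2) B).encard ≤ 9 := by
  have two : (2 : K) = 0 := CharTwo.two_eq_zero
  have hB1 : ∀ i, (pderiv i B).IsHomogeneous 3 := fun i => hB.pderiv
  have hQ : ∀ (v : Fin 3 → K) i, eval v (pderiv i (X 0 ^ 2 : MvPolynomial (Fin 3) K)) = 0 := by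
    intro v i
    simp [two]
  have hsing : ∀ v, IsSingDir (X 0 ^ 2) B v ↔
      ∃ w : K, eval v B = w * v 0 ^ 2 ∧ ∀ i, eval v (pderiv i B) = 0 := by
    intro v
    simp only [IsSingDir, hQ, mul_zero, map_pow, eval_X]
  have hX : Irreducible (X 0 : MvPolynomial (Fin 3) K) := (X_prime (i := 0)).irreducible
  -- If the line `x₀ = 0` were critical for `B`, the zeros of `B` on it would give singular lines.
  obtain ⟨i, hi⟩ : ∃ i, ¬ X 0 ∣ pderiv i B := by
    by_contra! hdvd
    obtain ⟨v, hv, hv0, hvB⟩ := exists_zero_on_linForm hB (by norm_num) (Pi.single 0 1)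
    have hv0 : v 0 = 0 := by simpa [Pi.single_apply] using hv0
    refine hN v hv (by simp [hv0]) (hQ v) hvB fun i => ?_
    obtain ⟨r, hr⟩ := hdvd i
    rw [hr, map_mul, eval_X, hv0, zero_mul]
  have hi0 : pderiv i B ≠ 0 := fun h => hi (h ▸ dvd_zero _)
  have hline : {p : ℙ K (Fin 3 → K) | p.rep 0 = 0 ∧ eval p.rep (pderiv i B) = 0}.Finite := by
    by_contra hinf
    obtain ⟨S, hS, hcard⟩ := Set.Infinite.exists_subset_card_eq hinf 4
    have := card_le_of_isRelPrime (isHomogeneous_X K 0) (hB1 i) (X_ne_zero _)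
      (hX.isRelPrime_iff_not_dvd.mpr hi) S fun p hp => by simpa using hS hp
    omega
  have hsub : projSing (X 0 ^ 2) B ⊆ {p : ℙ K (Fin 3 → K) | eval p.rep (pderiv i B) = 0 ∧
      ∀ j, eval p.rep (pderiv j B) = 0} := by
    intro p hp
    obtain ⟨w, -, h⟩ := (hsing _).mp hp
    exact ⟨h i, h⟩
  have hsup : {p : ℙ K (Fin 3 → K) | eval p.rep (pderiv i B) = 0 ∧
      ∀ j, eval p.rep (pderiv j B) = 0} ⊆ projSing (X 0 ^ 2) B ∪
        {p : ℙ K (Fin 3 → K) | p.rep 0 = 0 ∧ eval p.rep (pderiv i B) = 0} := by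
    rintro p ⟨hpi, hp⟩
    by_cases hx0 : p.rep 0 = 0
    · exact Or.inr ⟨hx0, hpi⟩
    · exact Or.inl ((hsing _).mpr ⟨eval p.rep B / p.rep 0 ^ 2, by field_simp, hp⟩)
  exact (Set.encard_le_encard hsub).trans
    (encard_zeros_le (hB1 i) hB1 hi0 ((hfin.union hline).subset hsup))

theorem encard_projSing_le_of_isDoublePlane {Q B : MvPolynomial (Fin 3) K}
    (hQ : Q.IsHomogeneous 2) (hB : B.IsHomogeneous 4) (hN : NoSingLine Q B)
    (hfin : (projSing Q B).Finite) (h : IsDoublePlane Q) : (projSing Q B).encard ≤ 9 := by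
  have : Infinite K := IsAlgClosed.instInfinite
  obtain ⟨l, hl, hl0, hQl⟩ := h
  obtain ⟨c, rfl⟩ := exists_linForm_eq hl
  have hc : c ≠ 0 := by
    rintro rfl
    exact hl0 (by simp [linForm])
  obtain ⟨d, hd⟩ := exists_linearIndependent_pair_of_one_lt_finrank (R := K)
    (by rw [Module.finrank_fin_fun]; norm_num) hc
  obtain ⟨A, hA, -⟩ := exists_linSubst_pair hd
  have hQA : linSubst A Q = X 0 ^ 2 := by rw [hQl, map_pow, hA]
  rw [← encard_projSing_linSubst A hQ hB, hQA]
  exact encard_projSing_X_sq_le (isHomogeneous_linSubst A hB) (hQA ▸ noSingLine_linSubst A hN)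
    (hQA ▸ finite_projSing_linSubst A hQ hB hfin)

theorem encard_projSing_le_of_isTwoPlanes {Q B : MvPolynomial (Fin 3) K}
    (hQ : Q.IsHomogeneous 2) (hB : B.IsHomogeneous 4)
    (hfin : (projSing Q B).Finite) (h : IsTwoPlanes Q) : (projSing Q B).encard ≤ 12 := by
  have : Infinite K := IsAlgClosed.instInfinite
  obtain ⟨l, m, hl, hm, hlm, hQlm⟩ := h
  obtain ⟨c, rfl⟩ := exists_linForm_eq hl
  obtain ⟨d, rfl⟩ := exists_linForm_eq hm
  have hcd : LinearIndependent K ![c, d] := by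
    rw [LinearIndependent.pair_iff] at hlm ⊢
    intro s t hst
    refine hlm s t ?_
    have hst' : ∀ i, s * c i + t * d i = 0 := fun i => congrFun hst i
    simp only [linForm, Finset.smul_sum, ← Finset.sum_add_distrib]
    refine Finset.sum_eq_zero fun i _ => ?_
    rw [smul_eq_C_mul, smul_eq_C_mul, ← mul_assoc, ← mul_assoc, ← C_mul, ← C_mul, ← add_mul,
      ← C_add, hst', C_0, zero_mul]
  obtain ⟨A, hA0, hA1⟩ := exists_linSubst_pair hcd
  have hQA : linSubst A Q = X 0 * X 1 := by rw [hQlm, map_mul, hA0, hA1]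
  rw [← encard_projSing_linSubst A hQ hB, hQA]
  exact encard_projSing_X_mul_X_le (isHomogeneous_linSubst A hB)
    (hQA ▸ finite_projSing_linSubst A hQ hB hfin)

theorem isDoublePlane_of_pderiv_eq_zero {Q : MvPolynomial (Fin 3) K} (hQ0 : Q ≠ 0)
    (a : Fin 3 → K) (h : Q = C (a 0) * X 0 ^ 2 + C (a 1) * X 1 ^ 2 + C (a 2) * X 2 ^ 2) :
    IsDoublePlane Q := by
  have two' : (2 : MvPolynomial (Fin 3) K) = 0 := CharTwo.two_eq_zero
  choose s hs using fun i => IsAlgClosed.exists_pow_nat_eq (a i) (n := 2) (by norm_num)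
  have hsq : Q = linForm s ^ 2 := by
    rw [h, linForm, Fin.sum_univ_three, ← hs, ← hs, ← hs, C_pow, C_pow, C_pow]
    linear_combination -(C (s 0) * X 0 * C (s 1) * X 1 + C (s 0) * X 0 * C (s 2) * X 2 +
      C (s 1) * X 1 * C (s 2) * X 2) * two'
  refine ⟨linForm s, isHomogeneous_linForm s, ?_, hsq⟩
  intro h0
  rw [h0] at hsq
  exact hQ0 (by simpa using hsq)

theorem encard_projSing_le {Q B : MvPolynomial (Fin 3) K} (hQ0 : Q ≠ 0)
    (hQ : Q.IsHomogeneous 2) (hB : B.IsHomogeneous 4) (hN : NoSingLine Q B)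
    (hfin : (projSing Q B).Finite) : (projSing Q B).encard ≤ 15 := by
  have : Infinite K := IsAlgClosed.instInfinite
  have two : (2 : K) = 0 := CharTwo.two_eq_zero
  obtain ⟨a, b, hab⟩ := exists_quadratic_eq hQ
  obtain ⟨p0, p1, p2⟩ := pderiv_quadratic a b hab
  by_cases hb : b = 0
  · refine (encard_projSing_le_of_isDoublePlane hQ hB hN hfin
      (isDoublePlane_of_pderiv_eq_zero hQ0 a ?_)).trans (by norm_num)
    simpa [hb] using hab
  · -- `b` is the vertex: it spans the kernel of the alternating polar form of `Q`.
    obtain ⟨A, hA⟩ := exists_linearEquiv_apply_single_two hb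
    have hQA := isHomogeneous_linSubst A hQ
    obtain ⟨a', b', hab'⟩ := exists_quadratic_eq hQA
    obtain ⟨q0, q1, q2⟩ := pderiv_quadratic a' b' hab'
    have hz : pderiv 2 (linSubst A Q) = 0 := by
      refine MvPolynomial.funext fun v => ?_
      rw [pderiv_linSubst, hA, Fin.sum_univ_three, p0, p1, p2]
      simp
      linear_combination (b 0 * b 2 * A v 1 + b 0 * b 1 * A v 2 + b 1 * b 2 * A v 0) * two
    rw [hz] at q2
    have hb0 : b' 0 = 0 := by simpa using (congrArg (eval (Pi.single 1 1)) q2).symm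
    have hb1 : b' 1 = 0 := by simpa using (congrArg (eval (Pi.single 0 1)) q2).symm
    have hb2 : b' 2 ≠ 0 := by
      intro hb2
      have hgrad : ∀ v i, eval v (pderiv i Q) = 0 := by
        intro v
        have := (forall_eval_pderiv_linSubst_eq_zero_iff A Q (A.symm v)).mp fun j => by
          fin_cases j
          · simp [q0, hb1, hb2]
          · simp [q1, hb0, hb2]
          · simp [hz]
        simpa using this
      apply hb
      ext i
      fin_cases i
      · simpa [p1] using hgrad (Pi.single 2 1) 1
      · simpa [p0] using hgrad (Pi.single 2 1) 0
      · simpa [p0] using hgrad (Pi.single 1 1) 0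
    rw [← encard_projSing_linSubst A hQ hB]
    exact encard_projSing_le_of_pderiv hQA (isHomogeneous_linSubst A hB) hb2
      (by simp [q0, hb1]) (by simp [q1, hb0]) hz (finite_projSing_linSubst A hQ hB hfin)

end CharTwo

/-! ### The singular locus and its projection -/

theorem mk_mem_Sing {K : Type*} [Field K] {F : MvPolynomial (Fin 4) K} {n : ℕ}
    (hF : F.IsHomogeneous n) (v : Fin 4 → K) (hv : v ≠ 0) :
    Projectivization.mk K v hv ∈ Sing F ↔ eval v F = 0 ∧ ∀ i, eval v (pderiv i F) = 0 := by
  rw [Sing, Set.mem_ofPred_eq, eval_rep_mk_eq_zero_iff hF v hv]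
  exact and_congr_right fun _ => forall_congr' fun i => eval_rep_mk_eq_zero_iff hF.pderiv v hv

theorem encard_Sing_inCoords {K : Type*} [Field K] (A : (Fin 4 → K) ≃ₗ[K] (Fin 4 → K))
    {F : MvPolynomial (Fin 4) K} {n : ℕ} (hF : F.IsHomogeneous n) :
    (Sing (inCoords A F)).encard = (Sing F).encard := by
  have hA : inCoords A F = linSubst A F := rfl
  have hv : ∀ v : Fin 4 → K, (eval v (inCoords A F) = 0 ∧
      ∀ i, eval v (pderiv i (inCoords A F)) = 0) ↔
        eval (A v) F = 0 ∧ ∀ i, eval (A v) (pderiv i F) = 0 := by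
    intro v
    rw [hA, eval_linSubst, forall_eval_pderiv_linSubst_eq_zero_iff]
  have himage : Projectivization.map A.toLinearMap A.injective '' Sing (inCoords A F) =
      Sing F := by
    ext p
    constructor
    · rintro ⟨q, hq, rfl⟩
      rw [← q.mk_rep, Projectivization.map_mk, mk_mem_Sing hF]
      exact (hv _).mp hq
    · intro hp
      have hne : A.symm p.rep ≠ 0 := by simpa using p.rep_nonzero
      refine ⟨Projectivization.mk K (A.symm p.rep) hne, ?_, ?_⟩
      · rw [mk_mem_Sing (hA ▸ isHomogeneous_linSubst A hF), hv, LinearEquiv.apply_symm_apply]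
        exact hp
      · rw [Projectivization.map_mk]
        conv_rhs => rw [← p.mk_rep]
        simp
  rw [← himage, (Projectivization.map_injective A.toLinearMap A.injective).injOn.encard_image]

theorem isHomogeneous_double_cover {K : Type*} [Field K] {Q B : MvPolynomial (Fin 3) K}
    (hQ : Q.IsHomogeneous 2) (hB : B.IsHomogeneous 4) :
    (X 3 ^ 2 * lift Q + lift B : MvPolynomial (Fin 4) K).IsHomogeneous 4 :=
  ((isHomogeneous_X_pow 3 2).mul hQ.rename_isHomogeneous).add hB.rename_isHomogeneous

theorem eval_snoc_lift {K : Type*} [Field K] (f : MvPolynomial (Fin 3) K) (x : Fin 3 → K) (z : K) :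
    eval (Fin.snoc (α := fun _ => K) x z) (lift f) = eval x f := by
  rw [lift, eval_rename, Fin.snoc_comp_castSucc]

theorem pderiv_castSucc_lift {K : Type*} [Field K] (f : MvPolynomial (Fin 3) K) (i : Fin 3) :
    pderiv i.castSucc (lift f) = lift (pderiv i f) :=
  pderiv_rename (Fin.castSucc_injective 3) i f

theorem pderiv_three_lift {K : Type*} [Field K] (f : MvPolynomial (Fin 3) K) :
    pderiv 3 (lift f) = 0 := by
  classical
  refine pderiv_eq_zero_of_notMem_vars fun h => ?_
  obtain ⟨i, -, hi⟩ := Finset.mem_image.mp (vars_rename _ _ h)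
  exact (Fin.castSucc_lt_last i).ne hi

/-- Since `∂/∂z` of `z² Q + B` vanishes in characteristic two, only the derivatives in the plane
matter. -/
theorem eval_snoc_singular_iff {K : Type*} [Field K] [CharP K 2] (Q B : MvPolynomial (Fin 3) K)
    (x : Fin 3 → K) (z : K) :
    (eval (Fin.snoc (α := fun _ => K) x z) (X 3 ^ 2 * lift Q + lift B) = 0 ∧
      ∀ i, eval (Fin.snoc (α := fun _ => K) x z) (pderiv i (X 3 ^ 2 * lift Q + lift B)) = 0) ↔
    eval x B = z ^ 2 * eval x Q ∧ ∀ i, eval x (pderiv i B) = z ^ 2 * eval x (pderiv i Q) := by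
  have hz : Fin.snoc (α := fun _ => K) x z (3 : Fin 4) = z := Fin.snoc_last (α := fun _ => K) z x
  have hzi : ∀ i : Fin 3, pderiv i.castSucc (X 3 : MvPolynomial (Fin 4) K) = 0 := fun i =>
    pderiv_X_of_ne (Fin.castSucc_lt_last i).ne'
  have two' : (2 : MvPolynomial (Fin 4) K) = 0 := CharTwo.two_eq_zero
  have h3 : pderiv 3 (X 3 ^ 2 * lift Q + lift B : MvPolynomial (Fin 4) K) = 0 := by
    simp [pderiv_three_lift, two']
  have hc : ∀ i : Fin 3, pderiv i.castSucc (X 3 ^ 2 * lift Q + lift B : MvPolynomial (Fin 4) K) =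
      X 3 ^ 2 * lift (pderiv i Q) + lift (pderiv i B) := by
    intro i
    rw [map_add, pderiv_mul, pderiv_pow, hzi, pderiv_castSucc_lift, pderiv_castSucc_lift]
    ring
  have heq : ∀ a b : K, a + b = 0 ↔ b = a := by
    intro a b
    rw [add_comm, CharTwo.add_eq_zero]
  rw [Fin.forall_fin_succ', show Fin.last 3 = 3 from rfl, h3, map_zero, and_iff_left rfl]
  simp only [hc, map_add, map_mul, map_pow, eval_X, hz, eval_snoc_lift, heq]

theorem snoc_ne_zero {K : Type*} [Field K] {x : Fin 3 → K} (hx : x ≠ 0) (z : K) :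
    Fin.snoc (α := fun _ => K) x z ≠ 0 := by
  intro h
  apply hx
  ext i
  have := congrFun h i.castSucc
  rwa [Fin.snoc_castSucc] at this

theorem smul_snoc {K : Type*} [Field K] (a : K) (x : Fin 3 → K) (z : K) :
    a • Fin.snoc (α := fun _ => K) x z = Fin.snoc (α := fun _ => K) (a • x) (a * z) := by
  ext i
  refine Fin.lastCases ?_ (fun i => ?_) i
  · rw [Pi.smul_apply, Fin.snoc_last, Fin.snoc_last, smul_eq_mul]
  · rw [Pi.smul_apply, Fin.snoc_castSucc, Fin.snoc_castSucc, Pi.smul_apply]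

theorem snoc_eq_snoc_iff {K : Type*} [Field K] {x y : Fin 3 → K} {z w : K} :
    Fin.snoc (α := fun _ => K) x z = Fin.snoc (α := fun _ => K) y w ↔ x = y ∧ z = w :=
  Fin.snoc_injective2.eq_iff

/-- At a common zero of `Q`, `∇Q`, `B`, `∇B` every `z` would give a singular point. -/
theorem noSingLine_of_isNormalSurface {K : Type*} [Field K] [Infinite K] [CharP K 2]
    {Q B : MvPolynomial (Fin 3) K} (hQ : Q.IsHomogeneous 2) (hB : B.IsHomogeneous 4)
    (h : (Sing (X 3 ^ 2 * lift Q + lift B)).Finite) : NoSingLine Q B := by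
  intro v hv hQ0 hQ1 hB0 hB1
  have hinj : Function.Injective fun z : K =>
      Projectivization.mk K (Fin.snoc (α := fun _ => K) v z) (snoc_ne_zero hv z) := by
    intro z w hzw
    obtain ⟨a, ha⟩ := (Projectivization.mk_eq_mk_iff' K _ _ _ _).mp hzw
    rw [smul_snoc, snoc_eq_snoc_iff] at ha
    obtain ⟨i, hi⟩ := Function.ne_iff.mp hv
    have ha1 : a = 1 := by
      have := congrFun ha.1 i
      rw [Pi.smul_apply, smul_eq_mul] at this
      exact mul_right_cancel₀ hi (this.trans (one_mul _).symm)
    simpa [ha1] using ha.2.symm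
  refine Set.infinite_range_of_injective hinj (h.subset ?_)
  rintro _ ⟨z, rfl⟩
  rw [mk_mem_Sing (isHomogeneous_double_cover hQ hB), eval_snoc_singular_iff]
  simp [hQ0, hQ1, hB0, hB1]

theorem origin_eq_mk_snoc (K : Type*) [Field K]
    (h : Fin.snoc (α := fun _ => K) (0 : Fin 3 → K) 1 ≠ 0) :
    origin K = Projectivization.mk K (Fin.snoc (α := fun _ => K) (0 : Fin 3 → K) 1) h := by
  rw [origin]
  congr 1
  ext i
  refine Fin.lastCases ?_ (fun i => ?_) i
  · rw [Fin.snoc_last]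
    exact Pi.single_eq_same _ _
  · rw [Fin.snoc_castSucc]
    exact Pi.single_eq_of_ne (Fin.castSucc_lt_last i).ne _

/-- Apart from the origin, the projection from the origin is injective on the singular points, as
squaring is bijective on `K`. -/
theorem encard_Sing_eq {K : Type*} [Field K] [IsAlgClosed K] [CharP K 2]
    {Q B : MvPolynomial (Fin 3) K} (hQ : Q.IsHomogeneous 2) (hB : B.IsHomogeneous 4)
    (hN : NoSingLine Q B) :
    (Sing (X 3 ^ 2 * lift Q + lift B)).encard = (projSing Q B).encard + 1 := by
  have hF := isHomogeneous_double_cover hQ hB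
  obtain ⟨z, hz⟩ : ∃ z : ℙ K (Fin 3 → K) → K, ∀ p ∈ projSing Q B,
      eval p.rep B = z p ^ 2 * eval p.rep Q ∧
        ∀ i, eval p.rep (pderiv i B) = z p ^ 2 * eval p.rep (pderiv i Q) := by
    have : ∀ p : ℙ K (Fin 3 → K), ∃ z : K, p ∈ projSing Q B →
      eval p.rep B = z ^ 2 * eval p.rep Q ∧
        ∀ i, eval p.rep (pderiv i B) = z ^ 2 * eval p.rep (pderiv i Q) := by
      intro p
      by_cases hp : p ∈ projSing Q B
      · obtain ⟨w, hw⟩ := hp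
        obtain ⟨z, rfl⟩ := IsAlgClosed.exists_pow_nat_eq w (n := 2) (by norm_num)
        exact ⟨z, fun _ => hw⟩
      · exact ⟨0, fun h => (hp h).elim⟩
    choose z hz using this
    exact ⟨z, hz⟩
  let ψ : ℙ K (Fin 3 → K) → P3 K := fun p =>
    Projectivization.mk K (Fin.snoc (α := fun _ => K) p.rep (z p)) (snoc_ne_zero p.rep_nonzero _)
  have hψ : Function.Injective ψ := by
    intro p q hpq
    obtain ⟨a, ha⟩ := (Projectivization.mk_eq_mk_iff' K _ _ _ _).mp hpq
    rw [smul_snoc, snoc_eq_snoc_iff] at ha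
    rw [← p.mk_rep, ← q.mk_rep, Projectivization.mk_eq_mk_iff']
    exact ⟨a, ha.1⟩
  have h01 : Fin.snoc (α := fun _ => K) (0 : Fin 3 → K) 1 ≠ 0 := fun h => by
    have := congrFun h (Fin.last 3)
    rw [Fin.snoc_last] at this
    exact one_ne_zero this
  have horigin : origin K ∉ ψ '' projSing Q B := by
    rintro ⟨p, -, hp⟩
    rw [origin_eq_mk_snoc K h01] at hp
    obtain ⟨a, ha⟩ := (Projectivization.mk_eq_mk_iff' K _ _ _ _).mp hp
    rw [smul_snoc, snoc_eq_snoc_iff, smul_zero] at ha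
    exact p.rep_nonzero ha.1.symm
  have heval0 : ∀ {f : MvPolynomial (Fin 3) K} {n : ℕ}, f.IsHomogeneous n → n ≠ 0 →
      eval 0 f = 0 := by
    intro f n hf hn
    simpa [hn] using eval_smul_of_isHomogeneous hf 0 0
  have hSing : Sing (X 3 ^ 2 * lift Q + lift B) = insert (origin K) (ψ '' projSing Q B) := by
    ext q
    rw [Set.mem_insert_iff]
    constructor
    · intro hq
      rw [or_iff_not_imp_left]
      intro hne
      obtain ⟨x, t, hxt⟩ : ∃ (x : Fin 3 → K) (t : K), q.rep = Fin.snoc (α := fun _ => K) x t :=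
        ⟨Fin.init q.rep, q.rep (Fin.last 3), (Fin.snoc_init_self (α := fun _ => K) q.rep).symm⟩
      obtain ⟨e0, e1⟩ : eval x B = t ^ 2 * eval x Q ∧
          ∀ i, eval x (pderiv i B) = t ^ 2 * eval x (pderiv i Q) := by
        rw [← eval_snoc_singular_iff, ← hxt]
        exact hq
      have hx : x ≠ 0 := by
        rintro rfl
        apply hne
        rw [← q.mk_rep, origin_eq_mk_snoc K h01, Projectivization.mk_eq_mk_iff']
        exact ⟨t, by rw [smul_snoc, smul_zero, mul_one, hxt]⟩
      have hp : Projectivization.mk K x hx ∈ projSing Q B :=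
        (mk_mem_projSing hQ hB x hx).mpr ⟨t ^ 2, e0, e1⟩
      obtain ⟨f0, f1⟩ := hz _ hp
      obtain ⟨a, ha⟩ := Projectivization.exists_smul_eq_mk_rep K x hx
      rw [Units.smul_def] at ha
      have ha0 : (a : K) ≠ 0 := a.ne_zero
      refine ⟨_, hp, ?_⟩
      have hza : z (Projectivization.mk K x hx) = a * t := by
        by_contra hza
        set p := Projectivization.mk K x hx
        have hsq : z p ^ 2 - (a * t) ^ 2 ≠ 0 := by
          rw [CharTwo.sub_eq_add, ← CharTwo.add_sq]
          refine pow_ne_zero 2 fun h => hza ?_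
          rwa [CharTwo.add_eq_zero] at h
        have hQ1 : ∀ i, (pderiv i Q).IsHomogeneous 1 := fun i => hQ.pderiv
        have hB1 : ∀ i, (pderiv i B).IsHomogeneous 3 := fun i => hB.pderiv
        have g0 : eval x Q = 0 := by
          rw [← ha, eval_smul_of_isHomogeneous hQ, eval_smul_of_isHomogeneous hB, e0] at f0
          refine (mul_eq_zero.mp (?_ : (a ^ 2 * (z p ^ 2 - (a * t) ^ 2)) * eval x Q =
            0)).resolve_left (mul_ne_zero (pow_ne_zero 2 ha0) hsq)
          linear_combination -f0
        have g1 : ∀ i, eval x (pderiv i Q) = 0 := by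
          intro i
          have f1 := f1 i
          rw [← ha, eval_smul_of_isHomogeneous (hQ1 i), eval_smul_of_isHomogeneous (hB1 i),
            e1] at f1
          refine (mul_eq_zero.mp (?_ : (a * (z p ^ 2 - (a * t) ^ 2)) * eval x (pderiv i Q) =
            0)).resolve_left (mul_ne_zero ha0 hsq)
          linear_combination -f1
        exact hN x hx g0 g1 (by rw [e0, g0, mul_zero]) fun i => by rw [e1, g1, mul_zero]
      rw [← q.mk_rep, Projectivization.mk_eq_mk_iff']
      exact ⟨a, by rw [hxt, smul_snoc, ha, hza]⟩
    · rintro (rfl | ⟨p, hp, rfl⟩)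
      · rw [origin_eq_mk_snoc K h01, mk_mem_Sing hF, eval_snoc_singular_iff]
        refine ⟨?_, fun i => ?_⟩
        · rw [heval0 hB (by norm_num), heval0 hQ (by norm_num), mul_zero]
        · rw [heval0 (hB.pderiv (i := i)) (by norm_num), heval0 (hQ.pderiv (i := i)) (by norm_num),
            mul_zero]
      · rw [mk_mem_Sing hF, eval_snoc_singular_iff]
        exact hz p hp
  rw [hSing, Set.encard_insert_of_notMem horigin, hψ.injOn.encard_image]

theorem ncard_Sing_le {K : Type*} [Field K] [IsAlgClosed K] [CharP K 2]
    {F : MvPolynomial (Fin 4) K} {P : P3 K} {A : (Fin 4 → K) ≃ₗ[K] (Fin 4 → K)}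
    {Q G B : MvPolynomial (Fin 3) K} (hF : F.IsHomogeneous 4) (hnormal : IsNormalSurface F)
    (h : IsTaylorAtDoublePoint F P A Q G B) (hG : G = 0) :
    (Sing F).ncard ≤ 16 ∧ (IsDoublePlane Q → (Sing F).ncard ≤ 10) ∧
      (IsTwoPlanes Q → (Sing F).ncard ≤ 13) := by
  have : Infinite K := IsAlgClosed.instInfinite
  have hQ := h.isHomogeneous_Q
  have hB := h.isHomogeneous_B
  have hA : inCoords A F = X 3 ^ 2 * lift Q + lift B := by
    rw [h.inCoords_eq, hG, lift, lift, lift, map_zero, mul_zero, add_zero]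
  have hcard := encard_Sing_inCoords A hF
  rw [hA] at hcard
  have hfin : (Sing (X 3 ^ 2 * lift Q + lift B)).Finite := by
    rwa [← Set.encard_lt_top_iff, hcard, Set.encard_lt_top_iff]
  have hN := noSingLine_of_isNormalSurface hQ hB hfin
  rw [encard_Sing_eq hQ hB hN] at hcard
  have hpfin : (projSing Q B).Finite := by
    rw [← Set.encard_lt_top_iff]
    refine lt_of_le_of_lt (le_self_add (b := 1)) ?_
    rw [hcard, Set.encard_lt_top_iff]
    exact hnormal
  have bound : ∀ n : ℕ, (projSing Q B).encard ≤ n → (Sing F).ncard ≤ n + 1 := by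
    intro n hn
    rw [← Nat.cast_le (α := ℕ∞), Set.Finite.cast_ncard_eq hnormal, ← hcard, Nat.cast_add,
      Nat.cast_one]
    gcongr
  exact ⟨bound 15 (encard_projSing_le h.Q_ne_zero hQ hB hN hpfin),
    fun hd => bound 9 (encard_projSing_le_of_isDoublePlane hQ hB hN hpfin hd),
    fun ht => bound 12 (encard_projSing_le_of_isTwoPlanes hQ hB hpfin ht)⟩

/-! ### The example with fourteen singular points -/

theorem isHomogeneous_exampleQ (K : Type*) [Field K] : (exampleQ K).IsHomogeneous 2 :=
  ((isHomogeneous_X K 0).mul (isHomogeneous_X K 1)).add (isHomogeneous_X_pow 2 2)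

theorem isHomogeneous_exampleB {K : Type*} [Field K] (a₁ a₂ a₃ : K) :
    (exampleB a₁ a₂ a₃).IsHomogeneous 4 := by
  have hY : (exampleY a₁ a₂ a₃).IsHomogeneous 1 :=
    ((isHomogeneous_C_mul_X a₁ 0).add (isHomogeneous_C_mul_X a₂ 1)).add
      (isHomogeneous_C_mul_X a₃ 2)
  have h0 := isHomogeneous_X K (0 : Fin 3)
  have h1 := isHomogeneous_X K (1 : Fin 3)
  exact (((hY.add h0).mul (hY.add h1)).mul hY).mul ((hY.add h0).add h1)

theorem exampleQ_ne_zero (K : Type*) [Field K] : exampleQ K ≠ 0 := by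
  intro h
  simpa [exampleQ] using congrArg (eval (Pi.single 2 1)) h

theorem isTaylorAtDoublePoint_exampleF {K : Type*} [Field K] (a₁ a₂ a₃ : K) :
    IsTaylorAtDoublePoint (exampleF a₁ a₂ a₃) (origin K) (LinearEquiv.refl K (Fin 4 → K))
      (exampleQ K) 0 (exampleB a₁ a₂ a₃) where
  point_eq := by
    rw [origin, Projectivization.map_mk]
    rfl
  isHomogeneous_Q := isHomogeneous_exampleQ K
  isHomogeneous_G := isHomogeneous_zero _ _ _
  isHomogeneous_B := isHomogeneous_exampleB a₁ a₂ a₃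
  Q_ne_zero := exampleQ_ne_zero K
  inCoords_eq := by
    have h : (fun i => ∑ j, C (LinearEquiv.refl K (Fin 4 → K) (Pi.single j 1) i) * X j :
        Fin 4 → MvPolynomial (Fin 4) K) = X := by
      ext1 i
      simp [Pi.single_apply]
    rw [inCoords, h, bind₁_X_left, AlgHom.id_apply, exampleF, lift, lift, lift, map_zero, mul_zero,
      add_zero]

theorem exists_isGeneral (K : Type*) [Field K] [Infinite K] [CharP K 2] :
    ∃ a₁ a₂ a₃ : K, IsGeneral a₁ a₂ a₃ := by
  classical
  obtain ⟨a, ha⟩ := Infinite.exists_notMem_finset ({0, 1} : Finset K)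
  have h : a ≠ 0 ∧ a ≠ 1 := by simpa using ha
  refine ⟨a, a, a, h, h, h, ?_⟩
  rwa [CharTwo.add_self_eq_zero, zero_add]

section CharTwo

variable {K : Type*} [Field K] [CharP K 2]

theorem eval_pderiv_exampleQ (v : Fin 3 → K) :
    eval v (pderiv 0 (exampleQ K)) = v 1 ∧ eval v (pderiv 1 (exampleQ K)) = v 0 ∧
      eval v (pderiv 2 (exampleQ K)) = 0 := by
  have two : (2 : K) = 0 := CharTwo.two_eq_zero
  simp [exampleQ, pderiv_X, two]

theorem noSingLine_exampleQ (B : MvPolynomial (Fin 3) K) : NoSingLine (exampleQ K) B := by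
  intro v hv h h' _ _
  obtain ⟨h0, h1, -⟩ := eval_pderiv_exampleQ v
  rw [h'] at h0 h1
  apply hv
  have h2 : v 2 = 0 := by simpa [exampleQ, ← h0, ← h1] using h
  ext i
  fin_cases i
  · exact h1.symm
  · exact h0.symm
  · exact h2

theorem exampleB_eq (a₁ a₂ a₃ : K) :
    exampleB a₁ a₂ a₃ = exampleY a₁ a₂ a₃ ^ 4 +
      exampleY a₁ a₂ a₃ ^ 2 * (X 0 ^ 2 + X 0 * X 1 + X 1 ^ 2) +
        exampleY a₁ a₂ a₃ * (X 0 * X 1 * (X 0 + X 1)) := by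
  have two' : (2 : MvPolynomial (Fin 3) K) = 0 := CharTwo.two_eq_zero
  rw [exampleB]
  linear_combination (exampleY a₁ a₂ a₃ ^ 3 * (X 0 + X 1) +
    exampleY a₁ a₂ a₃ ^ 2 * X 0 * X 1) * two'

theorem eval_exampleB (a₁ a₂ a₃ : K) (v : Fin 3 → K) {y : K}
    (hy : y = a₁ * v 0 + a₂ * v 1 + a₃ * v 2) :
    eval v (exampleB a₁ a₂ a₃) =
      y ^ 4 + y ^ 2 * (v 0 ^ 2 + v 0 * v 1 + v 1 ^ 2) + y * (v 0 * v 1 * (v 0 + v 1)) := by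
  subst hy
  simp [exampleB_eq, exampleY]

theorem eval_pderiv_exampleB (a₁ a₂ a₃ : K) (v : Fin 3 → K) {y : K}
    (hy : y = a₁ * v 0 + a₂ * v 1 + a₃ * v 2) :
    eval v (pderiv 0 (exampleB a₁ a₂ a₃)) =
        y ^ 2 * v 1 + y * v 1 ^ 2 + a₁ * (v 0 * v 1 * (v 0 + v 1)) ∧
      eval v (pderiv 1 (exampleB a₁ a₂ a₃)) =
        y ^ 2 * v 0 + y * v 0 ^ 2 + a₂ * (v 0 * v 1 * (v 0 + v 1)) ∧
      eval v (pderiv 2 (exampleB a₁ a₂ a₃)) = a₃ * (v 0 * v 1 * (v 0 + v 1)) := by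
  have two : (2 : K) = 0 := CharTwo.two_eq_zero
  have four : (4 : K) = 0 := by linear_combination 2 * two
  have hY : eval v (exampleY a₁ a₂ a₃) = y := by simp [exampleY, hy]
  have hY' : eval v (pderiv 0 (exampleY a₁ a₂ a₃)) = a₁ ∧
      eval v (pderiv 1 (exampleY a₁ a₂ a₃)) = a₂ ∧
      eval v (pderiv 2 (exampleY a₁ a₂ a₃)) = a₃ := by
    simp [exampleY, pderiv_X]
  obtain ⟨h0, h1, h2⟩ := hY'
  rw [exampleB_eq]
  refine ⟨?_, ?_, ?_⟩
  · simp [pderiv_X, h0, hY, two, four]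
    linear_combination (y * v 0 * v 1) * two
  · simp [pderiv_X, h1, hY, two, four]
    linear_combination (y * v 0 * v 1) * two
  · simp [pderiv_X, h2, hY, two, four]
    ring

/-- On each of the three lines `x₀ = 0`, `x₁ = 0`, `x₀ = x₁`, whose direction is `(α, β)` with
`α, β ∈ {0, 1}`, the condition to carry a singular point is a quartic equation in the value `y` of
the linear form. -/
theorem isSingDir_example_iff {a₁ a₂ a₃ α β : K} (h3 : a₃ ≠ 0) (hα : α ^ 2 = α) (hβ : β ^ 2 = β)
    (hαβ : α ≠ 0 ∨ β ≠ 0) (h1 : α ^ 2 + α * β + β ^ 2 = 1) (y : K) :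
    IsSingDir (exampleQ K) (exampleB a₁ a₂ a₃) ![α, β, (y + a₁ * α + a₂ * β) / a₃] ↔
      y = 0 ∨ y = 1 ∨
        (1 + a₃ ^ 2) * y ^ 2 + a₃ ^ 2 * y + (a₁ * α + a₂ * β + a₃ * (α * β)) ^ 2 = 0 := by
  have two : (2 : K) = 0 := CharTwo.two_eq_zero
  obtain ⟨t, ht⟩ : ∃ t, t = (y + a₁ * α + a₂ * β) / a₃ := ⟨_, rfl⟩
  rw [← ht]
  have hta : a₃ * t = y + a₁ * α + a₂ * β := by
    rw [ht]
    field_simp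
  have hy : y = a₁ * α + a₂ * β + a₃ * t := by
    rw [hta]
    linear_combination -(a₁ * α + a₂ * β) * two
  have hzero : α * β * (α + β) = 0 := by
    linear_combination β * hα + α * hβ + α * β * two
  obtain ⟨q0, q1, q2⟩ := eval_pderiv_exampleQ ![α, β, t]
  obtain ⟨b0, b1, b2⟩ := eval_pderiv_exampleB a₁ a₂ a₃ ![α, β, t] hy
  have b := eval_exampleB a₁ a₂ a₃ ![α, β, t] hy
  have q : eval ![α, β, t] (exampleQ K) = α * β + t ^ 2 := by simp [exampleQ]
  simp only [Matrix.cons_val] at q0 q1 q2 b0 b1 b2 b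
  rw [hzero] at b0 b1 b2 b
  rw [h1] at b
  have key : IsSingDir (exampleQ K) (exampleB a₁ a₂ a₃) ![α, β, t] ↔
      (y ^ 2 + y) * (α * β + t ^ 2) = (y ^ 2 + y) ^ 2 := by
    have e0 : y ^ 2 * β + y * β ^ 2 = (y ^ 2 + y) * β := by rw [hβ]; ring
    have e1 : y ^ 2 * α + y * α ^ 2 = (y ^ 2 + y) * α := by rw [hα]; ring
    have e : (y ^ 2 + y) ^ 2 = y ^ 4 + y ^ 2 := by linear_combination y ^ 3 * two
    simp only [IsSingDir, Fin.forall_fin_succ, Fin.succ_zero_eq_one,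
      Fin.succ_one_eq_two, q0, q1, q2, b0, b1, b2, b, q, mul_zero, add_zero, mul_one, e0, e1, e]
    constructor
    · rintro ⟨w, hw, w0, w1, -⟩
      have hw' : y ^ 2 + y = w := by
        rcases hαβ with h | h
        · exact mul_right_cancel₀ h w1
        · exact mul_right_cancel₀ h w0
      rw [hw, hw']
    · intro h
      exact ⟨y ^ 2 + y, h.symm, rfl, rfl, by simp⟩
  have hlin : y ^ 2 + y = 0 ↔ y = 0 ∨ y = 1 := by
    rw [show y ^ 2 + y = y * (y + 1) by ring, mul_eq_zero, CharTwo.add_eq_zero]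
  have hquad : α * β + t ^ 2 = y ^ 2 + y ↔
      (1 + a₃ ^ 2) * y ^ 2 + a₃ ^ 2 * y + (a₁ * α + a₂ * β + a₃ * (α * β)) ^ 2 = 0 := by
    have hsq : (a₁ * α + a₂ * β + a₃ * (α * β)) ^ 2 =
        (a₃ * t) ^ 2 + y ^ 2 + a₃ ^ 2 * (α * β) := by
      rw [hta, CharTwo.add_sq, CharTwo.add_sq, CharTwo.add_sq, CharTwo.add_sq]
      linear_combination a₃ ^ 2 * α ^ 2 * hβ + a₃ ^ 2 * β * hα - y ^ 2 * two
    rw [hsq, ← mul_right_inj' (pow_ne_zero 2 h3), ← sub_eq_zero]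
    constructor
    · intro h
      linear_combination h + (y ^ 2 + a₃ ^ 2 * (y ^ 2 + y)) * two
    · intro h
      linear_combination h - (y ^ 2 + a₃ ^ 2 * (y ^ 2 + y)) * two
  rw [key, sq (y ^ 2 + y), mul_eq_mul_left_iff, hquad, hlin, or_comm, or_assoc]

variable [IsAlgClosed K]

/-- The quadratic polynomial is separable as `c ≠ 0`, and its values at `0` and `1` are `δ²` and
`(1 + δ)²`. -/
theorem exists_card_four_roots {c δ : K} (hc0 : c ≠ 0) (hc1 : c ≠ 1) (hδ0 : δ ≠ 0) (hδ1 : δ ≠ 1) :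
    ∃ S : Finset K, S.card = 4 ∧
      ∀ y, y ∈ S ↔ y = 0 ∨ y = 1 ∨ (1 + c ^ 2) * y ^ 2 + c ^ 2 * y + δ ^ 2 = 0 := by
  classical
  have two : (2 : K) = 0 := CharTwo.two_eq_zero
  have hsq1 : ∀ x : K, x ≠ 1 → 1 + x ^ 2 ≠ 0 := by
    intro x hx h
    apply hx
    have : (1 + x) ^ 2 = 0 := by rw [CharTwo.add_sq, one_pow, h]
    exact (CharTwo.add_eq_zero.mp (eq_zero_of_pow_eq_zero this)).symm
  have hc := hsq1 c hc1
  obtain ⟨r, hr⟩ := IsAlgClosed.exists_root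
    (Polynomial.C (1 + c ^ 2) * Polynomial.X ^ 2 + Polynomial.C (c ^ 2) * Polynomial.X +
      Polynomial.C (δ ^ 2)) (by rw [Polynomial.degree_quadratic hc]; decide)
  have hr : (1 + c ^ 2) * r ^ 2 + c ^ 2 * r + δ ^ 2 = 0 := by simpa using hr
  set r' := r + c ^ 2 / (1 + c ^ 2) with hr'
  have hroots : ∀ y, (1 + c ^ 2) * y ^ 2 + c ^ 2 * y + δ ^ 2 = 0 ↔ y = r ∨ y = r' := by
    intro y
    have h : (1 + c ^ 2) * y ^ 2 + c ^ 2 * y + δ ^ 2 = (1 + c ^ 2) * ((y - r) * (y - r')) := by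
      have : (1 + c ^ 2) * r' = (1 + c ^ 2) * r + c ^ 2 := by
        rw [hr']
        field_simp
      linear_combination hr - (r - y) * this + ((1 + c ^ 2) * (y - r) * r + (y - r) * c ^ 2) * two
    rw [h, mul_eq_zero, or_iff_right hc, mul_eq_zero, sub_eq_zero, sub_eq_zero]
  have h0 : ¬ ((0 : K) = r ∨ (0 : K) = r') := by
    rw [← hroots]
    simpa using hδ0
  have h1 : ¬ ((1 : K) = r ∨ (1 : K) = r') := by
    rw [← hroots]
    intro h
    apply hsq1 δ hδ1
    linear_combination h - c ^ 2 * two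
  have hne : r ≠ r' := by
    rw [hr']
    intro h
    have : c ^ 2 / (1 + c ^ 2) = 0 := by linear_combination -h
    rw [div_eq_zero_iff] at this
    exact this.elim (pow_ne_zero 2 hc0) hc
  push Not at h0 h1
  refine ⟨{0, 1, r, r'}, ?_, fun y => ?_⟩
  · simp [Finset.card_insert_of_notMem, h0.1, h0.2, h1.1, h1.2, hne]
  · simp [hroots]

/-- The projected singular locus consists of `(0, 0, 1)` and of four points on each of three lines
through it. -/
theorem encard_projSing_example {a₁ a₂ a₃ : K} (h : IsGeneral a₁ a₂ a₃) :
    (projSing (exampleQ K) (exampleB a₁ a₂ a₃)).encard = 13 := by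
  classical
  obtain ⟨h1, h2, h3, h4⟩ := h
  have hQ := isHomogeneous_exampleQ K
  have hB := isHomogeneous_exampleB a₁ a₂ a₃
  let α : Fin 3 → K := ![0, 1, 1]
  let β : Fin 3 → K := ![1, 0, 1]
  let δ : Fin 3 → K := fun i => a₁ * α i + a₂ * β i + a₃ * (α i * β i)
  have hαβ : ∀ i, α i ≠ 0 ∨ β i ≠ 0 := by
    intro i
    fin_cases i <;> simp [α, β]
  have hdir : ∀ i j c, c * α j = α i → c * β j = β i → i = j ∧ c = 1 := by
    intro i j c e0 e1
    fin_cases i <;> fin_cases j <;> simp [α, β] at e0 e1 ⊢ <;> grind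
  have hδ : ∀ i, δ i ≠ 0 ∧ δ i ≠ 1 := by
    intro i
    fin_cases i <;> simp [δ, α, β, h1, h2, h4]
  choose S hcard hS using fun i => exists_card_four_roots h3.1 h3.2 (hδ i).1 (hδ i).2
  let v : (Σ _ : Fin 3, K) → Fin 3 → K := fun s =>
    ![α s.1, β s.1, (s.2 + a₁ * α s.1 + a₂ * β s.1) / a₃]
  have hv : ∀ s, v s ≠ 0 := by
    intro s hs
    have e0 : α s.1 = 0 := congrFun hs 0
    have e1 : β s.1 = 0 := congrFun hs 1
    exact (hαβ s.1).elim (fun h => h e0) (fun h => h e1)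
  have hsing : ∀ s, IsSingDir (exampleQ K) (exampleB a₁ a₂ a₃) (v s) ↔ s.2 ∈ S s.1 := by
    rintro ⟨i, y⟩
    rw [hS]
    refine isSingDir_example_iff h3.1 ?_ ?_ (hαβ i) ?_ y <;>
    · have two : (1 : K) + 1 + 1 = 1 := by rw [CharTwo.add_self_eq_zero, zero_add]
      fin_cases i <;> simp [α, β, two]
  let q : (Σ _ : Fin 3, K) → ℙ K (Fin 3 → K) := fun s => Projectivization.mk K (v s) (hv s)
  have hq : Function.Injective q := by
    rintro ⟨i, y⟩ ⟨j, x⟩ hij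
    obtain ⟨c, hc⟩ := (Projectivization.mk_eq_mk_iff' K _ _ _ _).mp hij
    have e0 : c * α j = α i := congrFun hc 0
    have e1 : c * β j = β i := congrFun hc 1
    have e2 : c * ((x + a₁ * α j + a₂ * β j) / a₃) = (y + a₁ * α i + a₂ * β i) / a₃ :=
      congrFun hc 2
    obtain ⟨rfl, rfl⟩ := hdir i j c e0 e1
    rw [one_mul, div_left_inj' h3.1, add_left_inj, add_left_inj] at e2
    rw [e2]
  have hne : (Pi.single 2 1 : Fin 3 → K) ≠ 0 := by simp
  have hT : projSing (exampleQ K) (exampleB a₁ a₂ a₃) =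
      insert (Projectivization.mk K (Pi.single 2 1) hne) (q '' (Finset.univ.sigma S)) := by
    ext p
    rw [Set.mem_insert_iff]
    constructor
    · intro hp
      rw [or_iff_not_imp_left]
      intro hpne
      have two : (2 : K) = 0 := CharTwo.two_eq_zero
      -- The derivative along the third coordinate confines `p` to the three lines.
      obtain ⟨i, c, hc0, hc, hc'⟩ : ∃ (i : Fin 3) (c : K), c ≠ 0 ∧ p.rep 0 = c * α i ∧
          p.rep 1 = c * β i := by
        obtain ⟨w, -, hw⟩ := hp
        have hw2 := hw 2
        rw [(eval_pderiv_exampleQ p.rep).2.2, (eval_pderiv_exampleB a₁ a₂ a₃ p.rep rfl).2.2,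
          mul_zero, mul_eq_zero, or_iff_right h3.1, mul_eq_zero, mul_eq_zero,
          CharTwo.add_eq_zero] at hw2
        have hor : p.rep 0 ≠ 0 ∨ p.rep 1 ≠ 0 := by
          by_contra! hboth
          exact hpne (projectivization_eq_mk_single_two hboth.1 hboth.2)
        rcases hw2 with (h0 | h0) | h0
        · exact ⟨0, p.rep 1, hor.resolve_left (fun h => h h0), by simp [α, h0], by simp [β]⟩
        · exact ⟨1, p.rep 0, hor.resolve_right (fun h => h h0), by simp [α], by simp [β, h0]⟩
        · refine ⟨2, p.rep 0, ?_, by simp [α], by simp [β, h0]⟩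
          intro h
          exact hor.elim (fun h' => h' h) (fun h' => h' (h0 ▸ h))
      let s : Σ _ : Fin 3, K := ⟨i, a₃ * (p.rep 2 / c) + a₁ * α i + a₂ * β i⟩
      have hps : p = q s := by
        conv_lhs => rw [← p.mk_rep]
        rw [Projectivization.mk_eq_mk_iff']
        refine ⟨c, ?_⟩
        have e : (s.2 + a₁ * α i + a₂ * β i) / a₃ = p.rep 2 / c := by
          rw [div_eq_iff h3.1]
          linear_combination (a₁ * α i + a₂ * β i) * two
        ext j
        fin_cases j
        · exact hc.symm
        · exact hc'.symm
        · change c * ((s.2 + a₁ * α i + a₂ * β i) / a₃) = p.rep 2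
          rw [e, mul_div_cancel₀ _ hc0]
      refine ⟨s, ?_, hps.symm⟩
      rw [hps, mk_mem_projSing hQ hB, hsing] at hp
      simpa using hp
    · rintro (rfl | ⟨s, hs, rfl⟩)
      · rw [mk_mem_projSing hQ hB]
        obtain ⟨q0, q1, q2⟩ := eval_pderiv_exampleQ (Pi.single 2 1 : Fin 3 → K)
        obtain ⟨b0, b1, b2⟩ := eval_pderiv_exampleB a₁ a₂ a₃ (Pi.single 2 1 : Fin 3 → K) rfl
        refine ⟨eval (Pi.single 2 1) (exampleB a₁ a₂ a₃), by simp [exampleQ], fun i => ?_⟩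
        fin_cases i
        · simp [q0, b0]
        · simp [q1, b1]
        · simp [q2, b2]
      · rw [mk_mem_projSing hQ hB, hsing]
        simpa using hs
  have hnot : Projectivization.mk K (Pi.single 2 1) hne ∉ q '' (Finset.univ.sigma S) := by
    rintro ⟨s, -, hs⟩
    obtain ⟨c, hc⟩ := (Projectivization.mk_eq_mk_iff' K _ _ _ _).mp hs
    have e0 : c * 0 = α s.1 := congrFun hc 0
    have e1 : c * 0 = β s.1 := congrFun hc 1
    rw [mul_zero] at e0 e1
    exact (hαβ s.1).elim (fun h => h e0.symm) (fun h => h e1.symm)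
  rw [hT, Set.encard_insert_of_notMem hnot, hq.injOn.encard_image, Set.encard_coe_eq_coe_finsetCard,
    Finset.card_sigma, Finset.sum_congr rfl fun i _ => hcard i]
  norm_num

theorem encard_Sing_exampleF {a₁ a₂ a₃ : K} (h : IsGeneral a₁ a₂ a₃) :
    (Sing (exampleF a₁ a₂ a₃)).encard = 14 := by
  rw [exampleF, encard_Sing_eq (isHomogeneous_exampleQ K) (isHomogeneous_exampleB a₁ a₂ a₃)
    (noSingLine_exampleQ _), encard_projSing_example h]
  norm_num

end CharTwo

end QuarticSurface

theorem proposition2p3 {K : Type*} [Field K] [IsAlgClosed K] [CharP K 2] :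
    (∀ (F : MvPolynomial (Fin 4) K) (P : QuarticSurface.P3 K)
        (A : (Fin 4 → K) ≃ₗ[K] (Fin 4 → K)) (Q G B : MvPolynomial (Fin 3) K),
        F.IsHomogeneous 4 → QuarticSurface.IsNormalSurface F →
        QuarticSurface.IsTaylorAtDoublePoint F P A Q G B → G = 0 →
          (QuarticSurface.Sing F).ncard ≤ 16 ∧
          (QuarticSurface.IsDoublePlane Q → (QuarticSurface.Sing F).ncard ≤ 10) ∧
          (QuarticSurface.IsTwoPlanes Q → (QuarticSurface.Sing F).ncard ≤ 13)) ∧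
    (∃ a₁ a₂ a₃ : K, QuarticSurface.IsGeneral a₁ a₂ a₃) ∧
    (∀ a₁ a₂ a₃ : K, QuarticSurface.IsGeneral a₁ a₂ a₃ →
        (QuarticSurface.exampleF a₁ a₂ a₃).IsHomogeneous 4 ∧
        QuarticSurface.IsNormalSurface (QuarticSurface.exampleF a₁ a₂ a₃) ∧
        QuarticSurface.IsTaylorAtDoublePoint (QuarticSurface.exampleF a₁ a₂ a₃)
          (QuarticSurface.origin K) (LinearEquiv.refl K (Fin 4 → K))
          (QuarticSurface.exampleQ K) 0 (QuarticSurface.exampleB a₁ a₂ a₃) ∧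
        (QuarticSurface.Sing (QuarticSurface.exampleF a₁ a₂ a₃)).ncard = 14) := by
  have : Infinite K := IsAlgClosed.instInfinite
  refine ⟨fun F P A Q G B hF hnormal h hG => QuarticSurface.ncard_Sing_le hF hnormal h hG,
    QuarticSurface.exists_isGeneral K, fun a₁ a₂ a₃ h => ?_⟩
  have hcard := QuarticSurface.encard_Sing_exampleF h
  refine ⟨QuarticSurface.isHomogeneous_double_cover (QuarticSurface.isHomogeneous_exampleQ K)
      (QuarticSurface.isHomogeneous_exampleB a₁ a₂ a₃), ?_,
    QuarticSurface.isTaylorAtDoublePoint_exampleF a₁ a₂ a₃, ?_⟩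
  · rw [QuarticSurface.IsNormalSurface, ← Set.encard_ne_top_iff, hcard]
    exact ENat.natCast_ne_top 14
  · rw [Set.ncard, hcard]
    rfl
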